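/- Let $L\ge 1$ and let $c_1,\dots,c_L$ be nonnegative integers with $c_1,c_L>0$, where $(L,c_1)\neq(1,1)$. Let $(H_n)_{n\ge1}$ be given by $H_1=1$, $H_{n+1}=c_1H_n+c_2H_{n-1}+\cdots+c_nH_1+1$ for $1\le n<L$, and $H_{n+1}=c_1H_n+\cdots+c_LH_{n+1-L}$ for $n\ge L$. Call a finite string $(a_1,\dots,a_m)$ of nonnegative integers with $a_1>0$ legal if either (i) $m<L$ and $a_i=c_i$ for $1\le i\le m$, or (ii) there are $s\in\{1,\dots,L\}$ and $\ell\ge 0$ such that $s+\ell\le m$, $a_i=c_i$ for $1\le i<s$, $a_s<c_s$, $a_{s+1}=\cdots=a_{s+\ell}=0$, and the remaining string $(a_{s+\ell+1},\dots,a_m)$ is empty or legal. A legal decomposition of a positive integer $N$ is a legal string $(a_1,\dots,a_m)$ with $N=\sum_{i=1}^m a_iH_{m+1-i}$. Then every positive integer $N$ has exactly one legal decomposition. Let $k(N)=a_1+\cdots+a_m$ be its number of summands. For every $n\ge1$ the set of integers in $[H_n,H_{n+1})$ is nonempty. Let $K_n=k(N)$ for $N$ chosen uniformly at random from this set, and let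 $\mu_n$ and $\sigma_n^2$ be the mean and the variance of $K_n$. Then, as $n\to\infty$, $(K_n-\mu_n)/\sigma_n$ converges in distribution to the standard normal distribution $N(0,1)$. (For the finitely many $n$ with $\sigma_n=0$, the quotient is read as $0$.) -/

import Mathlib

open MeasureTheory ProbabilityTheory Filter

/-- `H` (used at indices `1, 2, 3, …`; the value `H 0` is irrelevant) is the positive linear
recurrence sequence of length `L` with nonnegative integer coefficients `c 1, …, c L`, where
`c 1` and `c L` are positive. Values of `c` outside `1, …, L` are irrelevant. -/
structure IsPosLinRec (L : ℕ) (c H : ℕ → ℕ) : Prop where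
  one_le_length : 1 ≤ L
  first_pos : 0 < c 1
  last_pos : 0 < c L
  init : H 1 = 1
  rec_short : ∀ n, 1 ≤ n → n < L →
    H (n + 1) = ∑ i ∈ Finset.Icc 1 n, c i * H (n + 1 - i) + 1
  rec_long : ∀ n, L ≤ n → H (n + 1) = ∑ i ∈ Finset.Icc 1 L, c i * H (n + 1 - i)

/-- The list `[c 1, …, c m]`. -/
def coeffPrefix (c : ℕ → ℕ) (m : ℕ) : List ℕ := (List.range m).map fun i => c (i + 1)

/-- Legal coefficient strings `[a₁, …, aₘ]`, leading coefficient first. The leading coefficient is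
positive, and either `m < L` and `aᵢ = cᵢ` for all `i ≤ m`, or for some `1 ≤ s ≤ L` the string
starts with `c₁, …, c_{s-1}, a` where `a < c_s`, followed by some number (possibly none) of zeros,
followed by either nothing or another legal string. -/
inductive IsLegal (L : ℕ) (c : ℕ → ℕ) : List ℕ → Prop
  | short (m : ℕ) (hm : m < L) (hpos : 0 < (coeffPrefix c m).headD 0) :
      IsLegal L c (coeffPrefix c m)
  | last (s a l : ℕ) (hs : 1 ≤ s) (hsL : s ≤ L) (ha : a < c s)
      (hpos : 0 < (coeffPrefix c (s - 1) ++ [a]).headD 0) :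
      IsLegal L c (coeffPrefix c (s - 1) ++ [a] ++ List.replicate l 0)
  | block (s a l : ℕ) (b : List ℕ) (hs : 1 ≤ s) (hsL : s ≤ L) (ha : a < c s)
      (hpos : 0 < (coeffPrefix c (s - 1) ++ [a]).headD 0) (hb : IsLegal L c b) :
      IsLegal L c (coeffPrefix c (s - 1) ++ [a] ++ List.replicate l 0 ++ b)

/-- The integer `a₁ Hₘ + a₂ H_{m-1} + ⋯ + aₘ H₁` represented by the string `[a₁, …, aₘ]`. -/
def decompValue (H : ℕ → ℕ) : List ℕ → ℕ
  | [] => 0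
  | a :: t => a * H (t.length + 1) + decompValue H t

/-- `a` is a legal decomposition of the integer `N`. -/
def IsLegalDecomp (L : ℕ) (c H : ℕ → ℕ) (N : ℕ) (a : List ℕ) : Prop :=
  IsLegal L c a ∧ decompValue H a = N

open Classical in
/-- The number of summands `a₁ + ⋯ + aₘ` (counted with multiplicity) in the legal decomposition
of `N`; it is `0` if there is none. -/
noncomputable def numSummands (L : ℕ) (c H : ℕ → ℕ) (N : ℕ) : ℕ :=
  if h : ∃ a, IsLegalDecomp L c H N a then h.choose.sum else 0

/-- The uniform distribution on the integers in `[H n, H (n + 1))`. -/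
noncomputable def unifInterval (H : ℕ → ℕ) (n : ℕ) : Measure ℕ :=
  uniformOn (Set.Ico (H n) (H (n + 1)))

/-- The number of summands of an integer, centred by its mean and divided by its standard
deviation under the uniform distribution on `[H n, H (n + 1))`. -/
noncomputable def standardizedSummands (L : ℕ) (c H : ℕ → ℕ) (n : ℕ) (N : ℕ) : ℝ :=
  ((numSummands L c H N : ℝ) - ∫ M, (numSummands L c H M : ℝ) ∂(unifInterval H n)) /
    √(Var[fun M => (numSummands L c H M : ℝ); unifInterval H n])

/-! Decompositions. Once leading zeros are allowed, rule (ii) becomes "one block `c₁, …, c_s, a`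
with `a < c_{s+1}`, then any admissible string", since a zero is itself such a block (`c 1 > 0`).
Admissible strings of length `m` correspond bijectively to the integers in `[0, H (m + 1))`: by the
recurrence this interval is cut into copies of `[0, H (m - s))`, one for each first block, and for
`m < L` a single top integer is left over (`exists_admissible`, `Admissible.eq_of_decompValue_eq`).
Removing the first block lowers the number of summands by a constant, so the distribution of
summands is self-similar (`sum_numSummands`).

Gaussian limit. Divided by `H (m + 1)`, the generating functions satisfy a linear recurrence whose
weights at `z = 0` are probabilities, with the weight of the latest term bounded below. No dominant
root is studied. A contraction argument, stable under small complex perturbations, shows instead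
that on a disc independent of `m` these functions never vanish and consecutive ones have ratio close
to `1` (`exists_perturbation_bound`, `eventually_mgfBelow_close`). Telescoping the ratios gives an
analytic logarithm of size at most `m` on that disc (`exists_log_mgfIco`), so its Taylor remainder
of order three is `O(m |z|³)` (`norm_log_sub_cumulants_le`).

On the other side, conditioning on the first block shows that the variance grows at least linearly
in `m` (`exists_linear_le_sum_Ico`). At `z = i t / σ` the remainder is then `O(m / σ³) = O(1 / σ)`,
which tends to `0`, while the quadratic term is exactly `-t² / 2`. Lévy's continuity theorem
concludes. -/

namespace PosLinRec

variable {L : ℕ} {c H : ℕ → ℕ}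

/-! ### Existence and uniqueness of legal decompositions -/

/-- The sum `c₁ Hₘ + ⋯ + c_s H_{m+1-s}`. -/
def topSum (c H : ℕ → ℕ) (m s : ℕ) : ℕ := ∑ i ∈ Finset.range s, c (i + 1) * H (m - i)

/-- The sum `c₁ + ⋯ + c_s`. -/
def coeffSum (c : ℕ → ℕ) (s : ℕ) : ℕ := ∑ i ∈ Finset.range s, c (i + 1)

/-- Legal strings with leading zeros allowed, including the empty string. -/
inductive Admissible (L : ℕ) (c : ℕ → ℕ) : List ℕ → Prop
  | short (m : ℕ) (hm : m < L) : Admissible L c (coeffPrefix c m)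
  | block (s a : ℕ) (b : List ℕ) (hs : s < L) (ha : a < c (s + 1)) (hb : Admissible L c b) :
      Admissible L c (coeffPrefix c s ++ a :: b)

lemma topSum_succ (m s : ℕ) : topSum c H m (s + 1) = topSum c H m s + c (s + 1) * H (m - s) :=
  Finset.sum_range_succ _ _

lemma topSum_mono (m : ℕ) {s t : ℕ} (h : s ≤ t) : topSum c H m s ≤ topSum c H m t :=
  Finset.sum_le_sum_of_subset (Finset.range_mono h)

lemma sum_Icc_eq_topSum (m s : ℕ) : ∑ i ∈ Finset.Icc 1 s, c i * H (m + 1 - i) = topSum c H m s := by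
  induction s with
  | zero => simp [topSum]
  | succ s ih => rw [Finset.sum_Icc_succ_top (by omega), ih, topSum_succ, Nat.add_sub_add_right]

lemma topSum_length (hH : IsPosLinRec L c H) {m : ℕ} (hm : L ≤ m) :
    topSum c H m L = H (m + 1) := by
  rw [hH.rec_long m hm, sum_Icc_eq_topSum]

lemma topSum_self_add_one (hH : IsPosLinRec L c H) {m : ℕ} (hm : m < L) :
    topSum c H m m + 1 = H (m + 1) := by
  rcases Nat.eq_zero_or_pos m with rfl | h
  · simp [topSum, hH.init]
  · rw [hH.rec_short m h hm, sum_Icc_eq_topSum]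

lemma topSum_le (hH : IsPosLinRec L c H) {m s : ℕ} (hs : s ≤ L) (hm : s ≤ m) :
    topSum c H m s ≤ H (m + 1) := by
  rcases lt_or_ge m L with h | h
  · have := topSum_self_add_one hH h
    have := topSum_mono (c := c) (H := H) m hm
    omega
  · exact (topSum_mono m hs).trans (topSum_length hH h).le

lemma le_succ (hH : IsPosLinRec L c H) {m : ℕ} (hm : 1 ≤ m) : H m ≤ H (m + 1) := by
  have h := topSum_le hH (m := m) (s := 1) hH.one_le_length hm
  have h1 := hH.first_pos
  simp only [topSum, Finset.range_one, Finset.sum_singleton, zero_add, Nat.sub_zero] at h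
  nlinarith

lemma pos (hH : IsPosLinRec L c H) (m : ℕ) : 0 < H (m + 1) := by
  induction m with
  | zero => simp [hH.init]
  | succ m ih => exact ih.trans_le (le_succ hH (by omega))

lemma mono (hH : IsPosLinRec L c H) {m n : ℕ} (hm : 1 ≤ m) (hmn : m ≤ n) : H m ≤ H n := by
  induction n, hmn using Nat.le_induction with
  | base => rfl
  | succ n hn ih => exact ih.trans (le_succ hH (hm.trans hn))

/-- The excluded case is the constant sequence. Otherwise something is added to `c 1 * H m`: the `+
1` for `m < L`, the term of `c L > 0` for `m ≥ L ≥ 2`; and for `L = 1` the factor `c 1` is at least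
`2`. -/
lemma lt_succ (hH : IsPosLinRec L c H) (hne : ¬ (L = 1 ∧ c 1 = 1)) {m : ℕ} (hm : 1 ≤ m) :
    H m < H (m + 1) := by
  have h1 := hH.first_pos
  have hp : 0 < H m := by simpa [Nat.sub_add_cancel hm] using pos hH (m - 1)
  have hT1 : topSum c H m 1 = c 1 * H m := by simp [topSum]
  rcases lt_or_ge m L with h | h
  · have := topSum_self_add_one hH h
    have := topSum_mono (c := c) (H := H) m hm
    nlinarith
  · have hT := topSum_length hH h
    rcases Nat.lt_or_ge 1 L with hL | hL
    · obtain ⟨l, rfl⟩ : ∃ l, L = l + 2 := ⟨L - 2, by omega⟩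
      rw [topSum_succ] at hT
      have h2 := topSum_mono (c := c) (H := H) m (s := 1) (t := l + 1) (by omega)
      have h3 := hH.last_pos
      have h4 : 0 < H (m - (l + 1)) := by
        simpa [show m - (l + 1) - 1 + 1 = m - (l + 1) by omega] using pos hH (m - (l + 1) - 1)
      have h5 := Nat.mul_pos h3 h4
      nlinarith
    · obtain rfl : L = 1 := le_antisymm hL hH.one_le_length
      have : 2 ≤ c 1 := by
        rcases Nat.lt_or_ge (c 1) 2 with h | h
        · exact absurd ⟨rfl, by omega⟩ hne
        · exact h
      nlinarith

lemma length_coeffPrefix (s : ℕ) : (coeffPrefix c s).length = s := by simp [coeffPrefix]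

lemma coeffPrefix_succ (s : ℕ) : coeffPrefix c (s + 1) = coeffPrefix c s ++ [c (s + 1)] := by
  simp [coeffPrefix, List.range_succ]

lemma coeffPrefix_succ' (s : ℕ) :
    coeffPrefix c (s + 1) = c 1 :: (List.range s).map fun i => c (i + 2) := by
  simp [coeffPrefix, List.range_succ_eq_map, Function.comp_def]

lemma sum_coeffPrefix (s : ℕ) : (coeffPrefix c s).sum = coeffSum c s := by
  induction s with
  | zero => simp [coeffPrefix, coeffSum]
  | succ s ih => simp [coeffPrefix_succ, ih, coeffSum, Finset.sum_range_succ]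

lemma decompValue_coeffPrefix_append (s : ℕ) (y : List ℕ) :
    decompValue H (coeffPrefix c s ++ y) = topSum c H (s + y.length) s + decompValue H y := by
  induction s generalizing y with
  | zero => simp [coeffPrefix, topSum]
  | succ s ih =>
    rw [coeffPrefix_succ, List.append_assoc, List.singleton_append, ih, topSum_succ]
    simp only [List.length_cons, decompValue, show s + 1 + y.length - s = y.length + 1 by omega,
      show s + (y.length + 1) = s + 1 + y.length by omega]
    ring

lemma decompValue_block (s a : ℕ) (b : List ℕ) :
    decompValue H (coeffPrefix c s ++ a :: b) =
      topSum c H (s + b.length + 1) s + (a * H (b.length + 1) + decompValue H b) := by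
  rw [decompValue_coeffPrefix_append, decompValue, List.length_cons, add_assoc]

lemma decompValue_coeffPrefix (s : ℕ) : decompValue H (coeffPrefix c s) = topSum c H s s := by
  simpa [decompValue] using decompValue_coeffPrefix_append (c := c) (H := H) s []

lemma block_lt_topSum {m s a r : ℕ} (ha : a < c (s + 1)) (hr : r < H (m - s)) :
    topSum c H m s + (a * H (m - s) + r) < topSum c H m (s + 1) := by
  rw [topSum_succ]
  have := Nat.mul_le_mul_right (H (m - s)) (Nat.succ_le_of_lt ha)
  rw [Nat.succ_mul] at this
  omega

lemma Admissible.decompValue_lt (hH : IsPosLinRec L c H) {x : List ℕ} (hx : Admissible L c x) :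
    decompValue H x < H (x.length + 1) := by
  induction hx with
  | short m hm =>
    rw [decompValue_coeffPrefix, length_coeffPrefix, ← topSum_self_add_one hH hm]
    exact Nat.lt_succ_self _
  | block s a b hs ha hb ih =>
    have h := block_lt_topSum (H := H) (m := s + b.length + 1) ha
      (r := decompValue H b) (by simpa [show s + b.length + 1 - s = b.length + 1 by omega])
    rw [show s + b.length + 1 - s = b.length + 1 by omega] at h
    rw [decompValue_block]
    refine (h.trans_le (topSum_le hH hs (by omega))).trans_eq ?_
    simp [length_coeffPrefix, add_assoc]

/-- The intervals `[topSum m s, topSum m (s + 1))` are disjoint, so the value determines `s`;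
division by the next `H` then determines the digit `a`, and the remainder is the value of the tail.
A full prefix `coeffPrefix c m` has value `topSum m m`, above every block. -/
lemma Admissible.eq_of_decompValue_eq (hH : IsPosLinRec L c H) {x y : List ℕ}
    (hx : Admissible L c x) (hy : Admissible L c y) (hl : x.length = y.length)
    (hv : decompValue H x = decompValue H y) : x = y := by
  have key : ∀ m s a (b : List ℕ), s < L → a < c (s + 1) → Admissible L c b →
      s + b.length + 1 = m →
      decompValue H (coeffPrefix c s ++ a :: b) < topSum c H m (s + 1) ∧
      topSum c H m s ≤ decompValue H (coeffPrefix c s ++ a :: b) := by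
    rintro m s a b hs ha hb rfl
    have h := block_lt_topSum (H := H) (m := s + b.length + 1) ha (r := decompValue H b)
      (by simpa [show s + b.length + 1 - s = b.length + 1 by omega] using hb.decompValue_lt hH)
    rw [show s + b.length + 1 - s = b.length + 1 by omega] at h
    rw [decompValue_block]
    exact ⟨h, Nat.le_add_right _ _⟩
  induction hx generalizing y with
  | short m hm =>
    cases hy with
    | short n hn => rw [length_coeffPrefix, length_coeffPrefix] at hl; rw [hl]
    | block s a b hs ha hb =>
      simp only [length_coeffPrefix, List.length_append, List.length_cons] at hl
      have h := (key m s a b hs ha hb (by omega)).1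
      rw [decompValue_coeffPrefix] at hv
      have := topSum_mono (c := c) (H := H) m (s := s + 1) (t := m) (by omega)
      omega
  | block s a b hs ha hb ih =>
    cases hy with
    | short n hn =>
      simp only [length_coeffPrefix, List.length_append, List.length_cons] at hl
      have h := (key n s a b hs ha hb (by omega)).1
      rw [decompValue_coeffPrefix] at hv
      have := topSum_mono (c := c) (H := H) n (s := s + 1) (t := n) (by omega)
      omega
    | block s' a' b' hs' ha' hb' =>
      simp only [length_coeffPrefix, List.length_append, List.length_cons] at hl
      have h := key (s + b.length + 1) s a b hs ha hb rfl
      have h' := key (s + b.length + 1) s' a' b' hs' ha' hb' (by omega)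
      rcases lt_trichotomy s s' with hss | rfl | hss
      · have := topSum_mono (c := c) (H := H) (s + b.length + 1) (s := s + 1) (t := s') hss
        omega
      · have hbl : b.length = b'.length := by omega
        rw [decompValue_block, decompValue_block, hbl] at hv
        have hv' := Nat.add_left_cancel hv
        have hb1 := hb.decompValue_lt hH
        have hb1' := hb'.decompValue_lt hH
        rw [hbl] at hb1
        have hpos := pos hH b'.length
        have e1 : a = a' := by
          have := congrArg (· / H (b'.length + 1)) hv'
          simpa [Nat.add_comm (_ * _), Nat.add_mul_div_right _ _ hpos,
            Nat.div_eq_of_lt hb1, Nat.div_eq_of_lt hb1'] using this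
        subst e1
        rw [ih hb' hbl (Nat.add_left_cancel hv')]
      · have := topSum_mono (c := c) (H := H) (s + b.length + 1) (s := s' + 1) (t := s) hss
        omega

lemma exists_block_of_lt_topSum {m N s : ℕ} (h : N < topSum c H m s) :
    ∃ t < s, ∃ a < c (t + 1), ∃ r < H (m - t), N = topSum c H m t + (a * H (m - t) + r) := by
  induction s with
  | zero => simp [topSum] at h
  | succ s ih =>
    rcases lt_or_ge N (topSum c H m s) with hN | hN
    · obtain ⟨t, ht, rest⟩ := ih hN
      exact ⟨t, by omega, rest⟩
    · rw [topSum_succ] at h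
      have hlt : N - topSum c H m s < c (s + 1) * H (m - s) := by omega
      have hp : 0 < H (m - s) := Nat.pos_of_mul_pos_left (by omega : 0 < c (s + 1) * H (m - s))
      refine ⟨s, by omega, (N - topSum c H m s) / H (m - s), (Nat.div_lt_iff_lt_mul hp).2 hlt,
        (N - topSum c H m s) % H (m - s), Nat.mod_lt _ hp, ?_⟩
      rw [Nat.div_add_mod']
      omega

/-- Greedy algorithm: locate `N` between consecutive partial sums, divide, and recurse on the
remainder. -/
lemma exists_admissible (hH : IsPosLinRec L c H) (m N : ℕ) (hN : N < H (m + 1)) :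
    ∃ x, Admissible L c x ∧ x.length = m ∧ decompValue H x = N := by
  induction m using Nat.strong_induction_on generalizing N with
  | _ m ih =>
    have key : ∀ s ≤ L, s ≤ m → N < topSum c H m s →
        ∃ x, Admissible L c x ∧ x.length = m ∧ decompValue H x = N := by
      intro s hsL hsm h
      obtain ⟨t, ht, a, ha, r, hr, rfl⟩ := exists_block_of_lt_topSum h
      obtain ⟨b, hb, hbl, hbv⟩ := ih (m - t - 1) (by omega) r
        (by rwa [show m - t - 1 + 1 = m - t by omega])
      refine ⟨_, .block t a b (by omega) ha hb, ?_, ?_⟩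
      · simp only [List.length_append, List.length_cons, length_coeffPrefix]; omega
      · rw [decompValue_block, hbl, hbv, show t + (m - t - 1) + 1 = m by omega,
          show m - t - 1 + 1 = m - t by omega]
    rcases lt_or_ge m L with h | h
    · have hT := topSum_self_add_one hH h
      rcases Nat.lt_or_ge N (topSum c H m m) with hlt | hge
      · exact key m h.le le_rfl hlt
      -- The only value left is `N = H (m + 1) - 1`, which the short string represents.
      · refine ⟨_, .short m h, length_coeffPrefix m, ?_⟩
        rw [decompValue_coeffPrefix]; omega
    · exact key L le_rfl h (by rwa [topSum_length hH h])

lemma Admissible.replicate_append (h1 : 0 < c 1) (hL : 1 ≤ L) (l : ℕ) {b : List ℕ}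
    (hb : Admissible L c b) : Admissible L c (List.replicate l 0 ++ b) := by
  induction l with
  | zero => simpa
  | succ l ih => exact .block 0 0 _ hL h1 ih

lemma headD_coeffPrefix_append (h1 : 0 < c 1) (s a : ℕ) :
    0 < (coeffPrefix c s ++ [a]).headD 0 ↔ 0 < s ∨ 0 < a := by
  cases s with
  | zero => simp [coeffPrefix]
  | succ s => simp [coeffPrefix_succ', h1]

lemma headD_append_of_pos {x y : List ℕ} (h : 0 < x.headD 0) : 0 < (x ++ y).headD 0 := by
  cases x with
  | nil => simp at h
  | cons a x => simpa using h

lemma _root_.IsLegal.admissible (hH : IsPosLinRec L c H) {x : List ℕ} (hx : IsLegal L c x) :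
    Admissible L c x ∧ 0 < x.headD 0 := by
  have h1 := hH.first_pos
  have hL := hH.one_le_length
  induction hx with
  | short m hm hpos => exact ⟨.short m hm, hpos⟩
  | last s a l hs hsL ha hpos =>
    refine ⟨?_, headD_append_of_pos hpos⟩
    obtain ⟨s, rfl⟩ : ∃ t, s = t + 1 := ⟨s - 1, by omega⟩
    have h0 : Admissible L c (List.replicate l 0) := by
      simpa [coeffPrefix] using Admissible.replicate_append h1 hL l (Admissible.short 0 hL)
    simpa using Admissible.block s a _ hsL ha h0
  | block s a l b hs hsL ha hpos hb ih =>
    refine ⟨?_, by rw [List.append_assoc]; exact headD_append_of_pos hpos⟩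
    obtain ⟨s, rfl⟩ : ∃ t, s = t + 1 := ⟨s - 1, by omega⟩
    simpa using Admissible.block s a _ hsL ha (ih.1.replicate_append h1 hL l)

lemma Admissible.exists_legal (hH : IsPosLinRec L c H) {x : List ℕ} (hx : Admissible L c x) :
    ∃ l b, x = List.replicate l 0 ++ b ∧ (b = [] ∨ IsLegal L c b) := by
  have h1 := hH.first_pos
  induction hx with
  | short m hm =>
    cases m with
    | zero => exact ⟨0, [], by simp [coeffPrefix], Or.inl rfl⟩
    | succ m => exact ⟨0, _, rfl, Or.inr (.short _ hm (by simp [coeffPrefix_succ', h1]))⟩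
  | block s a b hs ha hb ih =>
    obtain ⟨l, b', rfl, hb'⟩ := ih
    by_cases h : 0 < s ∨ 0 < a
    · refine ⟨0, _, rfl, Or.inr ?_⟩
      rcases hb' with rfl | hb'
      · simpa using IsLegal.last (L := L) (s + 1) a l (by omega) hs ha
          ((headD_coeffPrefix_append h1 s a).2 h)
      · simpa using IsLegal.block (L := L) (s + 1) a l b' (by omega) hs ha
          ((headD_coeffPrefix_append h1 s a).2 h) hb'
    · obtain ⟨rfl, rfl⟩ : s = 0 ∧ a = 0 := by omega
      exact ⟨l + 1, b', by simp [coeffPrefix, List.replicate_succ], hb'⟩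

/-- This allows all later arguments to use the simpler induction on `Admissible`, where a run of
zeros needs no separate treatment. -/
lemma isLegal_iff (hH : IsPosLinRec L c H) {x : List ℕ} :
    IsLegal L c x ↔ Admissible L c x ∧ 0 < x.headD 0 := by
  refine ⟨fun h => h.admissible hH, fun ⟨h, hp⟩ => ?_⟩
  obtain ⟨l, b, rfl, hb⟩ := h.exists_legal hH
  cases l with
  | zero =>
    rcases hb with rfl | hb
    · simp at hp
    · simpa
  | succ l => simp [List.replicate_succ] at hp

lemma le_decompValue {x : List ℕ} (hx : 0 < x.headD 0) : H x.length ≤ decompValue H x := by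
  cases x with
  | nil => simp at hx
  | cons a x =>
    simp only [List.headD_cons] at hx
    simp only [List.length_cons, decompValue]
    nlinarith

lemma length_pos_of_headD {x : List ℕ} (hx : 0 < x.headD 0) : 1 ≤ x.length := by
  cases x with
  | nil => simp at hx
  | cons a x => simp

lemma existsUnique_isLegalDecomp (hH : IsPosLinRec L c H) (hne : ¬ (L = 1 ∧ c 1 = 1)) {N : ℕ}
    (hN : 1 ≤ N) : ∃! a : List ℕ, IsLegalDecomp L c H N a := by
  have hlen : ∀ x y : List ℕ, IsLegalDecomp L c H N x → IsLegalDecomp L c H N y →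
      x.length ≤ y.length := by
    rintro x y ⟨hx, hxv⟩ ⟨hy, hyv⟩
    by_contra! hlt
    have h1 := le_decompValue (H := H) (hx.admissible hH).2
    have h2 := (hy.admissible hH).1.decompValue_lt hH
    have := mono hH (m := y.length + 1) (n := x.length) (by omega) hlt
    omega
  have hgrow : ∀ m, m < H (m + 1) := by
    intro m
    induction m with
    | zero => simp [hH.init]
    | succ m ih => have := lt_succ hH hne (m := m + 1) (by omega); omega
  have hex : ∃ m, N < H (m + 1) := ⟨N, hgrow N⟩
  classical
  obtain ⟨x, hx, hxl, hxv⟩ := exists_admissible hH _ N (Nat.find_spec hex)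
  have hpos : 0 < x.headD 0 := by
    cases x with
    | nil => simp [decompValue] at hxv; omega
    | cons a t =>
      rw [List.headD_cons]
      by_contra h
      -- A leading zero could be deleted, giving an admissible string of smaller length for `N`,
      -- against the minimality of the length.
      obtain rfl : a = 0 := by omega
      refine Nat.find_min hex (m := t.length) (by simp [← hxl]) ?_
      have ht : Admissible L c t := by
        rcases hx.exists_legal hH with ⟨l, b, e, hb⟩
        have hbA : Admissible L c b := by
          rcases hb with rfl | hb
          · exact .short 0 hH.one_le_length
          · exact (hb.admissible hH).1
        cases l with
        | zero =>
          rcases hb with rfl | hb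
          · simp at e
          · have h2 := (hb.admissible hH).2
            simp only [List.replicate_zero, List.nil_append] at e
            rw [← e] at h2
            simp at h2
        | succ l =>
          rw [List.replicate_succ, List.cons_append, List.cons.injEq] at e
          rw [e.2]
          exact hbA.replicate_append hH.first_pos hH.one_le_length l
      rw [← hxv, decompValue, zero_mul, zero_add]
      exact ht.decompValue_lt hH
  refine ⟨x, ⟨(isLegal_iff hH).2 ⟨hx, hpos⟩, hxv⟩, fun y hy => ?_⟩
  have hxd : IsLegalDecomp L c H N x := ⟨(isLegal_iff hH).2 ⟨hx, hpos⟩, hxv⟩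
  exact (hy.1.admissible hH).1.eq_of_decompValue_eq hH hx
    (le_antisymm (hlen _ _ hy hxd) (hlen _ _ hxd hy)) (hy.2.trans hxv.symm)

/-! ### Self-similarity of the number of summands -/

lemma decompValue_replicate_append (l : ℕ) (b : List ℕ) :
    decompValue H (List.replicate l 0 ++ b) = decompValue H b := by
  induction l with
  | zero => simp
  | succ l ih => simpa [List.replicate_succ, decompValue] using ih

lemma one_le_of_isLegalDecomp (hH : IsPosLinRec L c H) {N : ℕ} {x : List ℕ}
    (h : IsLegalDecomp L c H N x) : 1 ≤ N := by
  have h1 := (h.1.admissible hH).2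
  have h2 := length_pos_of_headD h1
  have h3 := pos hH (x.length - 1)
  have h4 := le_decompValue (H := H) h1
  rw [Nat.sub_add_cancel h2] at h3
  rw [h.2] at h4
  omega

lemma numSummands_zero (hH : IsPosLinRec L c H) : numSummands L c H 0 = 0 := by
  rw [numSummands, dif_neg]
  rintro ⟨a, ha⟩
  have := one_le_of_isLegalDecomp hH ha
  omega

lemma numSummands_decompValue (hH : IsPosLinRec L c H) (hne : ¬ (L = 1 ∧ c 1 = 1)) {x : List ℕ}
    (hx : Admissible L c x) : numSummands L c H (decompValue H x) = x.sum := by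
  obtain ⟨l, b, rfl, hb⟩ := hx.exists_legal hH
  rw [decompValue_replicate_append]
  rcases hb with rfl | hb
  · simp [decompValue, numSummands_zero hH]
  · have hd : IsLegalDecomp L c H (decompValue H b) b := ⟨hb, rfl⟩
    have hex : ∃ a, IsLegalDecomp L c H (decompValue H b) a := ⟨b, hd⟩
    rw [numSummands, dif_pos hex, (existsUnique_isLegalDecomp hH hne
      (one_le_of_isLegalDecomp hH hd)).unique hex.choose_spec hd]
    simp

lemma numSummands_block (hH : IsPosLinRec L c H) (hne : ¬ (L = 1 ∧ c 1 = 1)) {m s a r : ℕ}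
    (hs : s < L) (hm : s < m) (ha : a < c (s + 1)) (hr : r < H (m - s)) :
    numSummands L c H (topSum c H m s + (a * H (m - s) + r)) =
      coeffSum c s + a + numSummands L c H r := by
  obtain ⟨b, hb, hbl, hbv⟩ := exists_admissible hH (m - s - 1) r
    (by rwa [show m - s - 1 + 1 = m - s by omega])
  have h := numSummands_decompValue hH hne (.block s a b hs ha hb)
  rw [decompValue_block, hbl, hbv, show s + (m - s - 1) + 1 = m by omega,
    show m - s - 1 + 1 = m - s by omega] at h
  rw [h, ← hbv, numSummands_decompValue hH hne hb, List.sum_append, List.sum_cons,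
    sum_coeffPrefix, add_assoc]

lemma sum_range_mul_add {E : Type*} [AddCommMonoid E] (F : ℕ → E) (k h : ℕ) :
    ∑ N ∈ Finset.range (k * h), F N =
      ∑ a ∈ Finset.range k, ∑ r ∈ Finset.range h, F (a * h + r) := by
  induction k with
  | zero => simp
  | succ k ih => rw [Nat.succ_mul, Finset.sum_range_add, ih, Finset.sum_range_succ]

/-- Splitting the integers below `H (m + 1)` according to the first block of the decomposition. -/
lemma sum_numSummands {E : Type*} [AddCommMonoid E] (hH : IsPosLinRec L c H)
    (hne : ¬ (L = 1 ∧ c 1 = 1)) (F : ℕ → E) {m : ℕ} (hm : L ≤ m) :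
    ∑ N ∈ Finset.range (H (m + 1)), F (numSummands L c H N) =
      ∑ s ∈ Finset.range L, ∑ a ∈ Finset.range (c (s + 1)), ∑ r ∈ Finset.range (H (m - s)),
        F (coeffSum c s + a + numSummands L c H r) := by
  have key : ∀ t ≤ L, ∑ N ∈ Finset.range (topSum c H m t), F (numSummands L c H N) =
      ∑ s ∈ Finset.range t, ∑ a ∈ Finset.range (c (s + 1)), ∑ r ∈ Finset.range (H (m - s)),
        F (coeffSum c s + a + numSummands L c H r) := by
    intro t ht
    induction t with
    | zero => simp [topSum]
    | succ t ih =>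
      rw [topSum_succ, Finset.sum_range_add, ih (by omega), Finset.sum_range_succ,
        sum_range_mul_add (fun N => F (numSummands L c H (topSum c H m t + N)))]
      congr 1
      refine Finset.sum_congr rfl fun a ha => Finset.sum_congr rfl fun r hr => ?_
      rw [numSummands_block hH hne (by omega) (by omega) (Finset.mem_range.1 ha)
        (Finset.mem_range.1 hr)]
  rw [← topSum_length hH hm]
  exact key L le_rfl

/-! ### Complex perturbations of averaging recurrences -/

/-- A lower bound on a window propagates through an averaging recurrence, and the excess of the
last value of the window over the bound decays at most geometrically. -/
lemma lower_propagation {W J : ℕ} {κ E lo : ℝ} {u : ℕ → ℝ} {p : ℕ → ℕ → ℝ} (hW : 0 < W)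
    (hκ : 0 ≤ κ) (hE : 0 ≤ E) (hp : ∀ j, ∀ s < W, 0 ≤ p j s)
    (hp1 : ∀ j, ∑ s ∈ Finset.range W, p j s = 1) (hp0 : ∀ j, κ ≤ p j 0)
    (hlo : ∀ i < W, lo ≤ u i)
    (hrec : ∀ j < J, ∑ s ∈ Finset.range W, p j s * u (W + j - 1 - s) - E ≤ u (W + j)) :
    ∀ j ≤ J, lo + κ ^ j * (u (W - 1) - lo) - j * E ≤ u (W - 1 + j) := by
  intro j
  induction j using Nat.strong_induction_on with
  | _ j ih =>
    intro hj
    cases j with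
    | zero => simp
    | succ j =>
      have hx : 0 ≤ u (W - 1) - lo := sub_nonneg.2 (hlo _ (by omega))
      have hjE : 0 ≤ (j : ℝ) * E := by positivity
      have hold : ∀ s < W, lo - j * E ≤ u (W + j - 1 - s) := by
        intro s hs
        rcases lt_or_ge (W + j - 1 - s) W with h | h
        · linarith [hlo _ h]
        · have h2 := ih (j - s) (by omega) (by omega)
          rw [show W - 1 + (j - s) = W + j - 1 - s by omega] at h2
          have h3 : ((j - s : ℕ) : ℝ) * E ≤ j * E := by gcongr; omega
          have h4 : 0 ≤ κ ^ (j - s) * (u (W - 1) - lo) := by positivity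
          linarith
      have h0 := ih j (by omega) (by omega)
      -- Only the term `s = 0` is used with its surviving excess; the others are bounded below by
      -- the flat value `lo - j * E`.
      have hsum : lo - j * E + p j 0 * (κ ^ j * (u (W - 1) - lo)) ≤
          ∑ s ∈ Finset.range W, p j s * u (W + j - 1 - s) := by
        obtain ⟨w, rfl⟩ : ∃ w, W = w + 1 := ⟨W - 1, by omega⟩
        have h1 := hp1 j
        rw [Finset.sum_range_succ'] at h1 ⊢
        have h2 : ∑ s ∈ Finset.range w, p j (s + 1) * (lo - j * E) ≤
            ∑ s ∈ Finset.range w, p j (s + 1) * u (w + 1 + j - 1 - (s + 1)) := by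
          refine Finset.sum_le_sum fun s hs => ?_
          rw [Finset.mem_range] at hs
          exact mul_le_mul_of_nonneg_left (hold (s + 1) (by omega)) (hp j _ (by omega))
        rw [← Finset.sum_mul, eq_sub_of_add_eq h1] at h2
        have h3 := mul_le_mul_of_nonneg_left h0 (hp j 0 (by omega))
        rw [show w + 1 - 1 + j = w + 1 + j - 1 - 0 by omega] at h3
        nlinarith
      have h5 := hrec j (by omega)
      have h6 : κ * (κ ^ j * (u (W - 1) - lo)) ≤ p j 0 * (κ ^ j * (u (W - 1) - lo)) :=
        mul_le_mul_of_nonneg_right (hp0 j) (by positivity)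
      rw [show W - 1 + (j + 1) = W + j by omega, pow_succ']
      push_cast
      linarith

/-- Norms are reduced to real parts in all directions `e`, so that the real-valued
`lower_propagation` applies to complex sequences. -/
lemma exists_norm_eq_re (z : ℂ) : ∃ e : ℂ, ‖e‖ = 1 ∧ (e * z).re = ‖z‖ := by
  rcases eq_or_ne z 0 with rfl | hz
  · exact ⟨1, by simp, by simp⟩
  · have hz' : (‖z‖ : ℂ) ≠ 0 := by simpa using hz
    refine ⟨(starRingEnd ℂ) z / ‖z‖, by simp [hz], ?_⟩
    rw [div_mul_eq_mul_div, ← Complex.normSq_eq_conj_mul_self, Complex.normSq_eq_norm_sq]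
    have : ((‖z‖ ^ 2 : ℝ) : ℂ) / ‖z‖ = ((‖z‖ : ℝ) : ℂ) := by
      push_cast; field_simp
    rw [this, Complex.ofReal_re]

/-- The values of `R` on the window `[m, m + W)` are nonzero and close to each other, relative to
the size of the last one. -/
def WindowClose (R : ℕ → ℂ) (W : ℕ) (η : ℝ) (m : ℕ) : Prop :=
  R (m + (W - 1)) ≠ 0 ∧ ∀ e : ℂ, ‖e‖ = 1 → ∃ lo : ℝ, ∀ i < W,
    lo ≤ (e * R (m + i)).re ∧ (e * R (m + i)).re ≤ lo + η * ‖R (m + (W - 1))‖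

lemma WindowClose.norm_sub_le {R : ℕ → ℂ} {W : ℕ} {η : ℝ} {m : ℕ} (h : WindowClose R W η m)
    {i j : ℕ} (hi : i < W) (hj : j < W) :
    ‖R (m + i) - R (m + j)‖ ≤ η * ‖R (m + (W - 1))‖ := by
  obtain ⟨e, he, hez⟩ := exists_norm_eq_re (R (m + i) - R (m + j))
  obtain ⟨lo, hlo⟩ := h.2 e he
  rw [← hez, mul_sub, Complex.sub_re]
  linarith [(hlo i hi).2, (hlo j hj).1]

lemma norm_le_of_recurrence {R : ℕ → ℂ} {W : ℕ} {ε B : ℝ} {m : ℕ} {a : ℕ → ℕ → ℂ}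
    {p : ℕ → ℕ → ℝ} (hε : 0 ≤ ε) (hB : 0 ≤ B) (hp : ∀ j, ∀ s < W, 0 ≤ p j s)
    (hp1 : ∀ j, ∑ s ∈ Finset.range W, p j s = 1)
    (ha : ∀ j, ∀ s < W, ‖a j s - p j s‖ ≤ ε * p j s)
    (hrec : ∀ m, R (m + W) = ∑ s ∈ Finset.range W, a m s * R (m + W - 1 - s))
    (hR : ∀ i < W, ‖R (m + i)‖ ≤ B) (j : ℕ) :
    ∀ i < W + j, ‖R (m + i)‖ ≤ (1 + ε) ^ j * B := by
  induction j with
  | zero => simpa using hR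
  | succ j ih =>
    intro i hi
    rcases Nat.lt_or_ge i (W + j) with h | h
    · refine (ih i h).trans ?_
      gcongr
      · linarith
      · omega
    · obtain rfl : i = W + j := by omega
      rw [show m + (W + j) = m + j + W by ring, hrec]
      calc ‖∑ s ∈ Finset.range W, a (m + j) s * R (m + j + W - 1 - s)‖
          ≤ ∑ s ∈ Finset.range W, p (m + j) s * ((1 + ε) * ((1 + ε) ^ j * B)) := by
            refine norm_sum_le_of_le _ fun s hs => ?_
            rw [Finset.mem_range] at hs
            have h1 : ‖a (m + j) s‖ ≤ p (m + j) s * (1 + ε) := by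
              have h2 := norm_le_norm_sub_add (a (m + j) s) (p (m + j) s : ℂ)
              rw [Complex.norm_real, Real.norm_of_nonneg (hp _ _ hs)] at h2
              linarith [ha (m + j) s hs]
            have h3 := ih (W + j - 1 - s) (by omega)
            rw [show m + (W + j - 1 - s) = m + j + W - 1 - s by omega] at h3
            rw [norm_mul, ← mul_assoc]
            exact mul_le_mul h1 h3 (norm_nonneg _) (mul_nonneg (hp _ _ hs) (by linarith))
        _ = (1 + ε) ^ (j + 1) * B := by rw [← Finset.sum_mul, hp1]; ring

/-- In each direction the averaging shrinks the spread of the window by the factor `1 - κ ^ W`: both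
ends of the interval move towards the last value. For small `ε` this gain exceeds the accumulated
perturbation and the possible decrease of the reference norm `‖R (m + (W - 1))‖`. -/
lemma WindowClose.add {R : ℕ → ℂ} {W : ℕ} {κ ε : ℝ} {m : ℕ} {a : ℕ → ℕ → ℂ}
    {p : ℕ → ℕ → ℝ} (hW : 0 < W) (hκ : 0 < κ) (hκ1 : κ ≤ 1) (hε : 0 ≤ ε)
    (hε1 : (1 + ε) ^ W ≤ 2) (hε2 : 8 * W * ε ≤ (κ ^ W) ^ 2 / 32)
    (hp : ∀ j, ∀ s < W, 0 ≤ p j s)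
    (hp1 : ∀ j, ∑ s ∈ Finset.range W, p j s = 1) (hp0 : ∀ j, κ ≤ p j 0)
    (ha : ∀ j, ∀ s < W, ‖a j s - p j s‖ ≤ ε * p j s)
    (hrec : ∀ m, R (m + W) = ∑ s ∈ Finset.range W, a m s * R (m + W - 1 - s))
    (h : WindowClose R W (κ ^ W / 16) m) : WindowClose R W (κ ^ W / 16) (m + W) := by
  set k := κ ^ W with hk
  have hk0 : 0 < k := by positivity
  have hk1 : k ≤ 1 := pow_le_one₀ hκ.le hκ1
  set r := R (m + (W - 1)) with hr
  have hr0 : 0 < ‖r‖ := norm_pos_iff.2 h.1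
  have hold : ∀ i < W, ‖R (m + i)‖ ≤ 2 * ‖r‖ := by
    intro i hi
    have h1 := h.norm_sub_le hi (show W - 1 < W by omega)
    have h2 := norm_le_norm_sub_add (R (m + i)) r
    nlinarith
  have hbd : ∀ i < W + W, ‖R (m + i)‖ ≤ 4 * ‖r‖ := by
    intro i hi
    have h1 := norm_le_of_recurrence hε (by positivity) hp hp1 ha hrec hold W i hi
    nlinarith
  -- Error of one step: relative error `ε` times the bound `4 * ‖r‖` valid on both windows.
  set E := 4 * ε * ‖r‖ with hE
  have hE0 : 0 ≤ E := by positivity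
  have herr : ∀ j < W, ‖R (m + j + W) -
      ∑ s ∈ Finset.range W, (p (m + j) s : ℂ) * R (m + j + W - 1 - s)‖ ≤ E := by
    intro j hj
    rw [hrec, ← Finset.sum_sub_distrib]
    calc _ ≤ ∑ s ∈ Finset.range W, p (m + j) s * E := by
          refine norm_sum_le_of_le _ fun s hs => ?_
          rw [Finset.mem_range] at hs
          have h3 := hbd (W + j - 1 - s) (by omega)
          rw [show m + (W + j - 1 - s) = m + j + W - 1 - s by omega] at h3
          rw [← sub_mul, norm_mul]
          have h4 := mul_le_mul (ha (m + j) s hs) h3 (norm_nonneg _)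
            (mul_nonneg hε (hp _ _ hs))
          rw [hE]
          linarith
      _ = E := by rw [← Finset.sum_mul, hp1, one_mul]
  have hre : ∀ e : ℂ, ‖e‖ = 1 → ∀ j < W, |(e * R (m + (W + j))).re -
      ∑ s ∈ Finset.range W, p (m + j) s * (e * R (m + (W + j - 1 - s))).re| ≤ E := by
    intro e he j hj
    have h1 : (e * R (m + (W + j))).re -
        ∑ s ∈ Finset.range W, p (m + j) s * (e * R (m + (W + j - 1 - s))).re =
        (e * (R (m + j + W) -
          ∑ s ∈ Finset.range W, (p (m + j) s : ℂ) * R (m + j + W - 1 - s))).re := by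
      rw [mul_sub, Complex.sub_re, Finset.mul_sum, Complex.re_sum,
        show m + (W + j) = m + j + W by ring]
      congr 1
      refine Finset.sum_congr rfl fun s hs => ?_
      rw [Finset.mem_range] at hs
      rw [mul_left_comm, Complex.re_ofReal_mul,
        show m + (W + j - 1 - s) = m + j + W - 1 - s by omega]
    rw [h1]
    refine (Complex.abs_re_le_norm _).trans ?_
    rw [norm_mul, he, one_mul]
    exact herr j hj
  have hprop : ∀ e : ℂ, ‖e‖ = 1 → ∃ lo : ℝ,
      (lo ≤ (e * r).re ∧ (e * r).re ≤ lo + k / 16 * ‖r‖) ∧ ∀ j < W,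
      lo + k * ((e * r).re - lo) - W * E ≤ (e * R (m + (W + j))).re ∧
      (e * R (m + (W + j))).re ≤
        lo + k / 16 * ‖r‖ - k * (lo + k / 16 * ‖r‖ - (e * r).re) + W * E := by
    intro e he
    obtain ⟨lo, hlo⟩ := h.2 e he
    have hx := hlo (W - 1) (by omega)
    refine ⟨lo, hx, fun j hj => ?_⟩
    have hpow : k ≤ κ ^ (j + 1) := pow_le_pow_of_le_one hκ.le hκ1 (by omega)
    have hjE : ((j + 1 : ℕ) : ℝ) * E ≤ W * E := by gcongr; omega
    have hl := lower_propagation (J := W) (u := fun i => (e * R (m + i)).re)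
      (p := fun j s => p (m + j) s) hW hκ.le hE0
      (fun j s hs => hp _ s hs) (fun j => hp1 _) (fun j => hp0 _) (fun i hi => (hlo i hi).1)
      (fun j hj => by linarith [(abs_le.1 (hre e he j hj)).1]) (j + 1) (by omega)
    -- The upper end of the interval is handled by applying the lower bound to the negated sequence.
    have hu := lower_propagation (J := W) (u := fun i => -(e * R (m + i)).re)
      (p := fun j s => p (m + j) s) (lo := -(lo + k / 16 * ‖r‖)) hW hκ.le hE0
      (fun j s hs => hp _ s hs) (fun j => hp1 _) (fun j => hp0 _)
      (fun i hi => neg_le_neg (hlo i hi).2)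
      (fun j hj => by
        have h1 := (abs_le.1 (hre e he j hj)).2
        simp only [mul_neg, Finset.sum_neg_distrib]
        linarith) (j + 1) (by omega)
    simp only [show W - 1 + (j + 1) = W + j by omega] at hl hu
    rw [← hr] at hl hu
    have h1 := mul_le_mul_of_nonneg_right hpow (sub_nonneg.2 hx.1)
    have h2 := mul_le_mul_of_nonneg_right hpow (sub_nonneg.2 hx.2)
    constructor <;> nlinarith
  have hWE : (W : ℝ) * E ≤ k ^ 2 / 64 * ‖r‖ := by
    rw [hE]; nlinarith
  have hr' : ‖r - R (m + W + (W - 1))‖ ≤ k / 8 * ‖r‖ := by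
    obtain ⟨e, he, hez⟩ := exists_norm_eq_re (r - R (m + W + (W - 1)))
    obtain ⟨lo, hlo, hj⟩ := hprop e he
    have h1 := (hj (W - 1) (by omega)).1
    rw [← hez, mul_sub, Complex.sub_re, add_assoc]
    have h2 : 0 ≤ k * ((e * r).re - lo) := mul_nonneg hk0.le (by linarith)
    have h3 : k ^ 2 / 64 * ‖r‖ ≤ k / 16 * ‖r‖ := by gcongr ?_ * _; nlinarith
    linarith [hlo.2]
  have hnorm : (1 - k / 8) * ‖r‖ ≤ ‖R (m + W + (W - 1))‖ := by
    have := norm_le_norm_sub_add r (R (m + W + (W - 1)))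
    linarith
  refine ⟨norm_pos_iff.1 (lt_of_lt_of_le (mul_pos (by linarith) hr0) hnorm), fun e he => ?_⟩
  obtain ⟨lo, hlo, hj⟩ := hprop e he
  refine ⟨lo + k * ((e * r).re - lo) - W * E, fun i hi => ?_⟩
  rw [add_assoc m W i]
  refine ⟨(hj i hi).1, (hj i hi).2.trans ?_⟩
  -- In units of `‖r‖`: the contraction gains `k² / 16`, the errors `2 * W * E` cost at most `k² /
  -- 32`, and the smaller reference norm costs `k² / 128`.
  have h1 : k / 16 * ((1 - k / 8) * ‖r‖) ≤ k / 16 * ‖R (m + W + (W - 1))‖ := by gcongr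
  nlinarith [mul_pos (pow_pos hk0 2) hr0]

/-- Solutions of a recurrence that is a small complex perturbation of an averaging recurrence
do not vanish and vary slowly. -/
lemma exists_perturbation_bound {W : ℕ} {κ : ℝ} (hW : 0 < W) (hκ : 0 < κ) (hκ1 : κ ≤ 1) :
    ∃ ε > 0, ∀ (R : ℕ → ℂ) (a : ℕ → ℕ → ℂ) (p : ℕ → ℕ → ℝ), (∀ j, ∀ s < W, 0 ≤ p j s) →
      (∀ j, ∑ s ∈ Finset.range W, p j s = 1) → (∀ j, κ ≤ p j 0) →
      (∀ j, ∀ s < W, ‖a j s - p j s‖ ≤ ε * p j s) →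
      (∀ m, R (m + W) = ∑ s ∈ Finset.range W, a m s * R (m + W - 1 - s)) →
      (∀ i < 2 * W, ‖R i - 1‖ ≤ ε) →
      ∀ m, R m ≠ 0 ∧ ∀ s < W, ‖R (m + s) - R m‖ ≤ 1 / 8 * ‖R m‖ := by
  have hk0 : 0 < κ ^ W := by positivity
  have hk1 : κ ^ W ≤ 1 := pow_le_one₀ hκ.le hκ1
  have e1 : ∀ᶠ ε : ℝ in nhdsWithin 0 (Set.Ioi 0), (1 + ε) ^ W < 2 := by
    refine nhdsWithin_le_nhds (ContinuousAt.eventually_lt (by fun_prop) (by fun_prop) ?_)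
    norm_num
  have e2 : ∀ᶠ ε : ℝ in nhdsWithin 0 (Set.Ioi 0), 8 * W * ε < (κ ^ W) ^ 2 / 32 := by
    refine nhdsWithin_le_nhds (ContinuousAt.eventually_lt (by fun_prop) (by fun_prop) ?_)
    simp only [mul_zero]; positivity
  have e3 : ∀ᶠ ε : ℝ in nhdsWithin 0 (Set.Ioi 0), ε < κ ^ W / 64 := by
    refine nhdsWithin_le_nhds (ContinuousAt.eventually_lt (by fun_prop) (by fun_prop) ?_)
    positivity
  obtain ⟨ε, ⟨⟨h1, h2⟩, h3⟩, hε⟩ := ((e1.and e2).and e3 |>.and self_mem_nhdsWithin).exists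
  replace hε : 0 < ε := hε
  refine ⟨ε, hε, fun R a p hp hp1 hp0 ha hrec hinit => ?_⟩
  have hwin : ∀ m, WindowClose R W (κ ^ W / 16) m := by
    intro m
    induction m using Nat.strong_induction_on with
    | _ m ih =>
      rcases Nat.lt_or_ge m W with hm | hm
      -- Since `WindowClose.add` advances by `W`, the `W` first windows need a direct proof; they
      -- involve only indices below `2 * W`, where `R` is close to `1`.
      · have hr := hinit (m + (W - 1)) (by omega)
        have hnorm : 1 / 2 ≤ ‖R (m + (W - 1))‖ := by
          have h4 := norm_le_norm_sub_add (1 : ℂ) (R (m + (W - 1)))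
          rw [norm_sub_rev, norm_one] at h4
          linarith
        refine ⟨norm_pos_iff.1 (by linarith), fun e he => ⟨e.re - ε, fun i hi => ?_⟩⟩
        have h4 : |(e * (R (m + i) - 1)).re| ≤ ε := by
          refine (Complex.abs_re_le_norm _).trans ?_
          rw [norm_mul, he, one_mul]
          exact hinit _ (by omega)
        rw [mul_sub, mul_one, Complex.sub_re] at h4
        obtain ⟨h5, h6⟩ := abs_le.1 h4
        have h7 : κ ^ W / 16 * (1 / 2) ≤ κ ^ W / 16 * ‖R (m + (W - 1))‖ := by gcongr
        exact ⟨by linarith, by linarith⟩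
      · have := (ih (m - W) (by omega)).add hW hκ hκ1 hε.le h1.le h2.le hp hp1 hp0 ha hrec
        rwa [Nat.sub_add_cancel hm] at this
  intro m
  have hm := hwin m
  have hr0 : 0 < ‖R (m + (W - 1))‖ := norm_pos_iff.2 hm.1
  have hm1 := hm.norm_sub_le (show W - 1 < W by omega) hW
  rw [add_zero] at hm1
  have h4 := norm_le_norm_sub_add (R (m + (W - 1))) (R m)
  have h5 : 15 / 16 * ‖R (m + (W - 1))‖ ≤ ‖R m‖ := by nlinarith
  refine ⟨norm_pos_iff.1 (by linarith), fun s hs => ?_⟩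
  have h6 := hm.norm_sub_le hs hW
  rw [add_zero] at h6
  refine h6.trans ?_
  nlinarith

/-! ### Moment generating functions and their logarithms -/

/-- Splitting the integers in `[H m, H (m + 1))` according to the first block of the
decomposition. -/
lemma sum_Ico_numSummands {E : Type*} [AddCommGroup E] (hH : IsPosLinRec L c H)
    (hne : ¬ (L = 1 ∧ c 1 = 1)) (F : ℕ → E) {m : ℕ} (hm : L ≤ m) :
    ∑ N ∈ Finset.Ico (H m) (H (m + 1)), F (numSummands L c H N) =
      ∑ s ∈ Finset.range L, ∑ a ∈ Finset.Ico (if s = 0 then 1 else 0) (c (s + 1)),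
        ∑ r ∈ Finset.range (H (m - s)), F (coeffSum c s + a + numSummands L c H r) := by
  have h1 := hH.first_pos
  obtain ⟨l, rfl⟩ : ∃ l, L = l + 1 := ⟨L - 1, by have := hH.one_le_length; omega⟩
  -- The piece `s = 0`, `a = 0` of `[0, H (m + 1))` is `[0, H m)` itself; removing it makes the
  -- first digit start at `1` when `s = 0`.
  rw [Finset.sum_Ico_eq_sub _ (le_succ hH (by omega)), sum_numSummands hH hne F hm,
    Finset.sum_range_succ', Finset.sum_range_succ' (n := l)]
  simp only [Nat.add_eq_zero_iff, one_ne_zero, and_false, if_false, Nat.Ico_zero_eq_range,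
    if_true, add_sub_assoc]
  congr 1
  rw [Finset.sum_Ico_eq_sub _ h1]
  simp [coeffSum]

/-- The unnormalized moment generating function of the number of summands on `[0, H (m + 1))`. -/
noncomputable def genFun (L : ℕ) (c H : ℕ → ℕ) (m : ℕ) (z : ℂ) : ℂ :=
  ∑ N ∈ Finset.range (H (m + 1)), Complex.exp (z * numSummands L c H N)

/-- The moment generating function of the number of summands on `[0, H (m + 1))`. -/
noncomputable def mgfBelow (L : ℕ) (c H : ℕ → ℕ) (m : ℕ) (z : ℂ) : ℂ :=
  genFun L c H m z / H (m + 1)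

/-- The moment generating function of the number of summands on `[H m, H (m + 1))`. -/
noncomputable def mgfIco (L : ℕ) (c H : ℕ → ℕ) (m : ℕ) (z : ℂ) : ℂ :=
  (∑ N ∈ Finset.Ico (H m) (H (m + 1)), Complex.exp (z * numSummands L c H N)) /
    ((H (m + 1) : ℂ) - H m)

/-- The weight `∑ₐ exp (z (c₁ + ⋯ + c_s + a))` with `a` running over a set of digits. -/
noncomputable def blockWeight (c : ℕ → ℕ) (A : Finset ℕ) (s : ℕ) (z : ℂ) : ℂ :=
  ∑ a ∈ A, Complex.exp (z * ((coeffSum c s + a : ℕ) : ℂ))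

lemma sum_blocks (A : ℕ → Finset ℕ) (m : ℕ) (z : ℂ) (hm : L ≤ m) :
    ∑ s ∈ Finset.range L, ∑ a ∈ A s, ∑ r ∈ Finset.range (H (m - s)),
      Complex.exp (z * ((coeffSum c s + a + numSummands L c H r : ℕ) : ℂ)) =
    ∑ s ∈ Finset.range L, blockWeight c (A s) s z * genFun L c H (m - 1 - s) z := by
  refine Finset.sum_congr rfl fun s hs => ?_
  rw [Finset.mem_range] at hs
  rw [blockWeight, genFun, Finset.sum_mul_sum, show m - 1 - s + 1 = m - s by omega]
  refine Finset.sum_congr rfl fun a _ => Finset.sum_congr rfl fun r _ => ?_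
  rw [← Complex.exp_add]
  congr 1
  push_cast
  ring

lemma genFun_rec (hH : IsPosLinRec L c H) (hne : ¬ (L = 1 ∧ c 1 = 1)) {m : ℕ} (hm : L ≤ m)
    (z : ℂ) : genFun L c H m z = ∑ s ∈ Finset.range L,
      blockWeight c (Finset.range (c (s + 1))) s z * genFun L c H (m - 1 - s) z := by
  rw [← sum_blocks _ m z hm, genFun,
    sum_numSummands hH hne (fun k => Complex.exp (z * (k : ℂ))) hm]

lemma sum_Ico_exp (hH : IsPosLinRec L c H) (hne : ¬ (L = 1 ∧ c 1 = 1)) {m : ℕ} (hm : L ≤ m)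
    (z : ℂ) : ∑ N ∈ Finset.Ico (H m) (H (m + 1)), Complex.exp (z * numSummands L c H N) =
      ∑ s ∈ Finset.range L, blockWeight c (Finset.Ico (if s = 0 then 1 else 0) (c (s + 1))) s z *
        genFun L c H (m - 1 - s) z := by
  rw [← sum_blocks _ m z hm, ← sum_Ico_numSummands hH hne (fun k => Complex.exp (z * (k : ℂ))) hm]

/-- The proportion of integers below `H (m + 1)` whose decomposition starts with a block of
length `s + 1`. -/
noncomputable def blockProb (c H : ℕ → ℕ) (m s : ℕ) : ℝ :=
  (c (s + 1) * H (m - s) : ℝ) / H (m + 1)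

lemma blockProb_nonneg (m s : ℕ) : 0 ≤ blockProb c H m s := by
  unfold blockProb; positivity

lemma sum_blockProb (hH : IsPosLinRec L c H) {m : ℕ} (hm : L ≤ m) :
    ∑ s ∈ Finset.range L, blockProb c H m s = 1 := by
  have hp : (H (m + 1) : ℝ) ≠ 0 := by exact_mod_cast (pos hH m).ne'
  simp only [blockProb]
  rw [← Finset.sum_div, div_eq_one_iff_eq hp, ← topSum_length hH hm, topSum]
  push_cast
  rfl

lemma coeffSum_pos (hH : IsPosLinRec L c H) {s : ℕ} (hs : 1 ≤ s) : 1 ≤ coeffSum c s := by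
  have h1 := hH.first_pos
  refine le_trans ?_ (Finset.single_le_sum (f := fun i => c (i + 1)) (fun _ _ => Nat.zero_le _)
    (Finset.mem_range.2 (show 0 < s by omega)))
  simpa using Nat.succ_le_of_lt h1

lemma succ_le_mul (hH : IsPosLinRec L c H) {m : ℕ} (hm : L ≤ m) :
    H (m + 1) ≤ coeffSum c L * H m := by
  rw [← topSum_length hH hm, topSum, coeffSum, Finset.sum_mul]
  refine Finset.sum_le_sum fun i hi => ?_
  rw [Finset.mem_range] at hi
  exact Nat.mul_le_mul_left _ (mono hH (by omega) (by omega))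

lemma inv_le_div (hH : IsPosLinRec L c H) {m : ℕ} (hm : L ≤ m) :
    (coeffSum c L : ℝ)⁻¹ ≤ (H m : ℝ) / H (m + 1) := by
  have hp : (0 : ℝ) < H (m + 1) := by exact_mod_cast pos hH m
  have hc : (0 : ℝ) < coeffSum c L := by exact_mod_cast coeffSum_pos hH hH.one_le_length
  rw [le_div_iff₀ hp, inv_mul_le_iff₀ hc]
  exact_mod_cast succ_le_mul hH hm

lemma inv_le_blockProb (hH : IsPosLinRec L c H) {m : ℕ} (hm : L ≤ m) :
    (coeffSum c L : ℝ)⁻¹ ≤ blockProb c H m 0 := by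
  refine (inv_le_div hH hm).trans ?_
  have h1 : (1 : ℝ) ≤ c 1 := by exact_mod_cast hH.first_pos
  unfold blockProb
  simp only [zero_add, Nat.sub_zero]
  gcongr
  nlinarith [(Nat.cast_nonneg (H m) : (0 : ℝ) ≤ H m)]

lemma eventually_blockWeight_close (A : Finset ℕ) (s : ℕ) {ε : ℝ} (hε : 0 < ε) :
    ∀ᶠ z in nhds (0 : ℂ), ‖blockWeight c A s z - A.card‖ ≤ ε * A.card := by
  rcases A.eq_empty_or_nonempty with rfl | hA
  · simp [blockWeight]
  · have hcard : (0 : ℝ) < A.card := by exact_mod_cast hA.card_pos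
    refine (ContinuousAt.eventually_lt (f := fun z => ‖blockWeight c A s z - A.card‖)
      (g := fun _ => ε * A.card) ?_ continuousAt_const ?_).mono fun z hz => hz.le
    · unfold blockWeight; fun_prop
    · simpa [blockWeight] using mul_pos hε hcard

lemma mgfBelow_zero (hH : IsPosLinRec L c H) (m : ℕ) : mgfBelow L c H m 0 = 1 := by
  have hp : (H (m + 1) : ℂ) ≠ 0 := by exact_mod_cast (pos hH m).ne'
  simp [mgfBelow, genFun, hp]

lemma differentiable_mgfBelow (m : ℕ) : Differentiable ℂ (mgfBelow L c H m) := by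
  unfold mgfBelow genFun; fun_prop

lemma differentiable_mgfIco (m : ℕ) : Differentiable ℂ (mgfIco L c H m) := by
  unfold mgfIco; fun_prop

lemma mgfBelow_zero_left (hH : IsPosLinRec L c H) (z : ℂ) : mgfBelow L c H 0 z = 1 := by
  simp [mgfBelow, genFun, hH.init, numSummands_zero hH]

lemma genFun_eq (hH : IsPosLinRec L c H) (m : ℕ) (z : ℂ) :
    genFun L c H m z = H (m + 1) * mgfBelow L c H m z := by
  have hp : (H (m + 1) : ℂ) ≠ 0 := by exact_mod_cast (pos hH m).ne'
  rw [mgfBelow, mul_div_cancel₀ _ hp]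

/-- Near the origin, the moment generating functions do not vanish and vary slowly with `m`. -/
lemma eventually_mgfBelow_close (hH : IsPosLinRec L c H) (hne : ¬ (L = 1 ∧ c 1 = 1)) :
    ∀ᶠ z in nhds (0 : ℂ), ∀ m, mgfBelow L c H m z ≠ 0 ∧ ∀ s ≤ L,
      ‖mgfBelow L c H (m + s) z - mgfBelow L c H m z‖ ≤ 1 / 8 * ‖mgfBelow L c H m z‖ := by
  have hc : (1 : ℝ) ≤ coeffSum c L := by exact_mod_cast coeffSum_pos hH hH.one_le_length
  -- Windows of length `L + 1`, with a zero weight appended to the recurrence, so that indices at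
  -- distance exactly `L` are compared too; for `L = 1` this is what gives consecutive ratios.
  obtain ⟨ε, hε, h⟩ := exists_perturbation_bound (W := L + 1) (κ := (coeffSum c L : ℝ)⁻¹)
    (by omega) (by positivity) (inv_le_one_of_one_le₀ hc)
  have h1 : ∀ᶠ z in nhds (0 : ℂ), ∀ s ∈ Finset.range L,
      ‖blockWeight c (Finset.range (c (s + 1))) s z - c (s + 1)‖ ≤ ε * c (s + 1) := by
    rw [Finset.eventually_all]
    intro s _
    simpa using eventually_blockWeight_close (c := c) (Finset.range (c (s + 1))) s hε
  have h2 : ∀ᶠ z in nhds (0 : ℂ), ∀ i ∈ Finset.range (2 * (L + 1)),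
      ‖mgfBelow L c H i z - 1‖ ≤ ε := by
    rw [Finset.eventually_all]
    intro i _
    refine (ContinuousAt.eventually_lt (f := fun z => ‖mgfBelow L c H i z - 1‖)
      (g := fun _ => ε) ?_ continuousAt_const ?_).mono fun z hz => hz.le
    · exact ((differentiable_mgfBelow i).continuous.sub continuous_const).norm.continuousAt
    · simpa [mgfBelow_zero hH] using hε
  filter_upwards [h1, h2] with z hz1 hz2 m
  have := h (fun m => mgfBelow L c H m z)
    (fun m s => if s < L then blockWeight c (Finset.range (c (s + 1))) s z *
      ((H (m + (L + 1) - s) / H (m + (L + 1) + 1) : ℝ) : ℂ) else 0)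
    (fun m s => if s < L then blockProb c H (m + (L + 1)) s else 0) ?_ ?_ ?_ ?_ ?_ ?_ m
  · exact ⟨this.1, fun s hs => this.2 s (by omega)⟩
  · intro j s _
    split_ifs
    · exact blockProb_nonneg _ _
    · exact le_rfl
  · intro j
    rw [Finset.sum_range_succ, if_neg (lt_irrefl _), add_zero,
      ← sum_blockProb hH (m := j + (L + 1)) (by omega)]
    exact Finset.sum_congr rfl fun s hs => if_pos (Finset.mem_range.1 hs)
  · intro j
    rw [if_pos (by have := hH.one_le_length; omega)]
    exact inv_le_blockProb hH (by omega)
  · intro j s _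
    split_ifs with hs
    · have h3 := hz1 s (Finset.mem_range.2 hs)
      have h4 : (0 : ℝ) ≤ H (j + (L + 1) - s) / H (j + (L + 1) + 1) := by positivity
      rw [blockProb, mul_div_assoc, Complex.ofReal_mul, Complex.ofReal_natCast, ← sub_mul, norm_mul,
        Complex.norm_real, Real.norm_of_nonneg h4, ← mul_assoc]
      exact mul_le_mul_of_nonneg_right h3 h4
    · simp
  · intro j
    have hp : (H (j + (L + 1) + 1) : ℂ) ≠ 0 := by exact_mod_cast (pos hH _).ne'
    rw [Finset.sum_range_succ, if_neg (lt_irrefl _), zero_mul, add_zero, mgfBelow,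
      genFun_rec hH hne (by omega), Finset.sum_div]
    refine Finset.sum_congr rfl fun s hs => ?_
    rw [Finset.mem_range] at hs
    rw [if_pos hs, genFun_eq hH, show j + (L + 1) - 1 - s + 1 = j + (L + 1) - s by omega]
    push_cast
    field_simp
  · exact fun i hi => hz2 i (Finset.mem_range.2 hi)

lemma sum_Ico_card (hH : IsPosLinRec L c H) (hne : ¬ (L = 1 ∧ c 1 = 1)) {m : ℕ} (hm : L ≤ m) :
    (H (m + 1) : ℝ) - H m = ∑ s ∈ Finset.range L,
      ((Finset.Ico (if s = 0 then 1 else 0) (c (s + 1))).card : ℝ) * H (m - s) := by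
  have h := sum_Ico_numSummands hH hne (fun _ => (1 : ℝ)) hm
  simp only [Finset.sum_const, nsmul_eq_mul, mul_one, Finset.card_range] at h
  rw [← h, Nat.card_Ico, Nat.cast_sub (le_succ hH (by have := hH.one_le_length; omega))]

/-- The function on `[H m, H (m + 1))` is nearly a weighted average of the `mgfBelow` at the indices
`m - 1 - s` with `s < L`. These all lie within `L` of `m - L`, so they are close to the value there.
-/
lemma eventually_mgfIco_close (hH : IsPosLinRec L c H) (hne : ¬ (L = 1 ∧ c 1 = 1)) :
    ∀ᶠ z in nhds (0 : ℂ), ∀ m, L ≤ m →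
      ‖mgfIco L c H m z - mgfBelow L c H (m - L) z‖ ≤ 1 / 2 * ‖mgfBelow L c H (m - L) z‖ := by
  have h1 : ∀ᶠ z in nhds (0 : ℂ), ∀ s ∈ Finset.range L,
      ‖blockWeight c (Finset.Ico (if s = 0 then 1 else 0) (c (s + 1))) s z -
        (Finset.Ico (if s = 0 then 1 else 0) (c (s + 1))).card‖ ≤
      1 / 8 * (Finset.Ico (if s = 0 then 1 else 0) (c (s + 1))).card := by
    rw [Finset.eventually_all]
    exact fun s _ => eventually_blockWeight_close _ s (by norm_num)
  filter_upwards [h1, eventually_mgfBelow_close hH hne] with z hz1 hz2 m hm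
  have hL := hH.one_le_length
  have hcard := sum_Ico_card hH hne hm
  have hlt : (H m : ℝ) < H (m + 1) := by exact_mod_cast lt_succ hH hne (hL.trans hm)
  set B := ‖mgfBelow L c H (m - L) z‖
  set d : ℕ → ℝ := fun s => (Finset.Ico (if s = 0 then 1 else 0) (c (s + 1))).card with hd
  have hd0 : ∀ s, 0 ≤ d s := fun s => by positivity
  have hpos : (0 : ℝ) < H (m + 1) - H m := by linarith
  have hcast : ((H (m + 1) : ℂ) - H m) = ((H (m + 1) - H m : ℝ) : ℂ) := by push_cast; rfl
  have hne0 : ((H (m + 1) - H m : ℝ) : ℂ) ≠ 0 := by exact_mod_cast hpos.ne'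
  have e0 : ∀ w : ℂ, ‖w‖ * (H (m + 1) - H m) = ‖w * ((H (m + 1) - H m : ℝ) : ℂ)‖ := fun w => by
    rw [norm_mul, Complex.norm_real, Real.norm_of_nonneg hpos.le]
  refine le_of_mul_le_mul_right ?_ hpos
  rw [e0, mgfIco, sum_Ico_exp hH hne hm, hcast, sub_mul, div_mul_cancel₀ _ hne0, hcard]
  push_cast
  rw [Finset.mul_sum, ← Finset.sum_sub_distrib, Finset.mul_sum]
  refine norm_sum_le_of_le _ fun s hs => ?_
  have hsL := Finset.mem_range.1 hs
  have h3 := (hz2 (m - L)).2 (L - 1 - s) (by omega)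
  rw [show m - L + (L - 1 - s) = m - 1 - s by omega] at h3
  have h4 := hz1 s hs
  have h5 : ‖mgfBelow L c H (m - 1 - s) z‖ ≤ 9 / 8 * B := by
    have := norm_le_norm_sub_add (mgfBelow L c H (m - 1 - s) z) (mgfBelow L c H (m - L) z)
    linarith
  rw [genFun_eq hH, show m - 1 - s + 1 = m - s by omega]
  set x := blockWeight c (Finset.Ico (if s = 0 then 1 else 0) (c (s + 1))) s z
  set R := mgfBelow L c H (m - 1 - s) z
  set R0 := mgfBelow L c H (m - L) z
  have e : x * ((H (m - s) : ℂ) * R) - R0 *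
      (((Finset.Ico (if s = 0 then 1 else 0) (c (s + 1))).card : ℂ) * (H (m - s) : ℂ)) =
      (H (m - s) : ℂ) * ((x - (Finset.Ico (if s = 0 then 1 else 0) (c (s + 1))).card) * R +
        ((Finset.Ico (if s = 0 then 1 else 0) (c (s + 1))).card : ℂ) * (R - R0)) := by ring
  rw [e, norm_mul, Complex.norm_natCast]
  have h6 : ‖(x - (Finset.Ico (if s = 0 then 1 else 0) (c (s + 1))).card) * R +
        ((Finset.Ico (if s = 0 then 1 else 0) (c (s + 1))).card : ℂ) * (R - R0)‖ ≤
      1 / 2 * B * d s := by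
    refine (norm_add_le _ _).trans ?_
    rw [norm_mul, norm_mul, Complex.norm_natCast]
    have h7 := mul_le_mul h4 h5 (norm_nonneg _) (mul_nonneg (by norm_num) (hd0 s))
    have h8 := mul_le_mul_of_nonneg_left h3 (hd0 s)
    have h9 : 0 ≤ d s * B := mul_nonneg (hd0 s) (norm_nonneg _)
    simp only [hd] at h7 h8 h9 ⊢
    linarith
  calc _ ≤ (H (m - s) : ℝ) * (1 / 2 * B * d s) := by gcongr
    _ = _ := by ring

lemma norm_div_sub_one_le {x y : ℂ} (hy : y ≠ 0) (h : ‖x - y‖ ≤ 1 / 2 * ‖y‖) :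
    ‖x / y - 1‖ ≤ 1 / 2 := by
  rw [div_sub_one hy, norm_div, div_le_iff₀ (norm_pos_iff.2 hy)]
  exact h

lemma norm_log_le {w : ℂ} (h : ‖w - 1‖ ≤ 1 / 2) : ‖Complex.log w‖ ≤ 1 := by
  have := Complex.norm_log_one_add_half_le_self h
  rw [add_sub_cancel] at this
  linarith

lemma mem_slitPlane_of_norm_sub_one_le {w : ℂ} (h : ‖w - 1‖ ≤ 1 / 2) : w ∈ Complex.slitPlane := by
  have := Complex.mem_slitPlane_of_norm_lt_one (z := w - 1) (by linarith)
  rwa [add_sub_cancel] at this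

/-- On a fixed disc, the moment generating functions on `[H m, H (m + 1))` have analytic
logarithms of size at most linear in `m`. -/
lemma exists_log_mgfIco (hH : IsPosLinRec L c H) (hne : ¬ (L = 1 ∧ c 1 = 1)) :
    ∃ ρ > 0, ∀ m, L ≤ m → ∃ f : ℂ → ℂ, DifferentiableOn ℂ f (Metric.ball 0 ρ) ∧ f 0 = 0 ∧
      ∀ z ∈ Metric.ball (0 : ℂ) ρ, Complex.exp (f z) = mgfIco L c H m z ∧ ‖f z‖ ≤ m := by
  obtain ⟨ρ, hρ, hball⟩ := Metric.eventually_nhds_iff_ball.1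
    ((eventually_mgfBelow_close hH hne).and (eventually_mgfIco_close hH hne))
  have hL := hH.one_le_length
  have hR0 : ∀ z ∈ Metric.ball (0 : ℂ) ρ, ∀ j, mgfBelow L c H j z ≠ 0 :=
    fun z hz j => ((hball z hz).1 j).1
  have hR : ∀ z ∈ Metric.ball (0 : ℂ) ρ, ∀ j,
      ‖mgfBelow L c H (j + 1) z / mgfBelow L c H j z - 1‖ ≤ 1 / 2 := by
    intro z hz j
    refine norm_div_sub_one_le (hR0 z hz j) ((((hball z hz).1 j).2 1 hL).trans ?_)
    gcongr
    norm_num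
  have hF : ∀ z ∈ Metric.ball (0 : ℂ) ρ, ∀ m, L ≤ m →
      ‖mgfIco L c H m z / mgfBelow L c H (m - L) z - 1‖ ≤ 1 / 2 :=
    fun z hz m hm => norm_div_sub_one_le (hR0 z hz _) ((hball z hz).2 m hm)
  -- The principal logarithm is applied to each ratio of the telescoping product: every ratio is
  -- within `1 / 2` of `1`, so each term is analytic and of norm at most `1`, whereas the product
  -- itself may leave the slit plane.
  refine ⟨ρ, hρ, fun m hm => ⟨fun z =>
    Complex.log (mgfIco L c H m z / mgfBelow L c H (m - L) z) + ∑ j ∈ Finset.range (m - L),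
      Complex.log (mgfBelow L c H (j + 1) z / mgfBelow L c H j z), ?_, ?_, fun z hz => ⟨?_, ?_⟩⟩⟩
  · refine DifferentiableOn.add ?_ (DifferentiableOn.fun_sum fun j _ => ?_)
    · exact DifferentiableOn.clog ((differentiable_mgfIco m).differentiableOn.div
        (differentiable_mgfBelow _).differentiableOn fun z hz => hR0 z hz _)
        fun z hz => mem_slitPlane_of_norm_sub_one_le (hF z hz m hm)
    · exact DifferentiableOn.clog ((differentiable_mgfBelow _).differentiableOn.div
        (differentiable_mgfBelow _).differentiableOn fun z hz => hR0 z hz _)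
        fun z hz => mem_slitPlane_of_norm_sub_one_le (hR z hz j)
  · have hlt := lt_succ hH hne (hL.trans hm)
    have h1 : (H (m + 1) : ℂ) - H m ≠ 0 := by
      rw [sub_ne_zero]; exact_mod_cast hlt.ne'
    simp [mgfBelow_zero hH, mgfIco, Nat.cast_sub hlt.le, h1]
  · have hne0 : mgfIco L c H m z / mgfBelow L c H (m - L) z ≠ 0 :=
      Complex.slitPlane_ne_zero (mem_slitPlane_of_norm_sub_one_le (hF z hz m hm))
    have key : ∀ n, Complex.exp (∑ j ∈ Finset.range n,
        Complex.log (mgfBelow L c H (j + 1) z / mgfBelow L c H j z)) = mgfBelow L c H n z := by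
      intro n
      induction n with
      | zero => simp [mgfBelow_zero_left hH]
      | succ n ih =>
        rw [Finset.sum_range_succ, Complex.exp_add, ih,
          Complex.exp_log (div_ne_zero (hR0 z hz _) (hR0 z hz _)),
          mul_div_cancel₀ _ (hR0 z hz _)]
    rw [Complex.exp_add, key, Complex.exp_log hne0, div_mul_cancel₀ _ (hR0 z hz _)]
  · refine (norm_add_le _ _).trans ?_
    have h1 : ‖∑ j ∈ Finset.range (m - L),
        Complex.log (mgfBelow L c H (j + 1) z / mgfBelow L c H j z)‖ ≤ ((m - L : ℕ) : ℝ) := by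
      refine (norm_sum_le_of_le (f := fun j =>
        Complex.log (mgfBelow L c H (j + 1) z / mgfBelow L c H j z)) _
        fun j _ => norm_log_le (hR z hz j)).trans ?_
      simp
    have h2 := norm_log_le (hF z hz m hm)
    have h3 : 1 + ((m - L : ℕ) : ℝ) ≤ m := by
      have : 1 + (m - L) ≤ m := by omega
      exact_mod_cast this
    linarith

/-! ### Linear growth of the variance -/

/-- The mean number of summands on `[0, H (m + 1))`. -/
noncomputable def meanBelow (L : ℕ) (c H : ℕ → ℕ) (m : ℕ) : ℝ :=
  (∑ N ∈ Finset.range (H (m + 1)), (numSummands L c H N : ℝ)) / H (m + 1)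

/-- The variance of the number of summands on `[0, H (m + 1))`. -/
noncomputable def varBelow (L : ℕ) (c H : ℕ → ℕ) (m : ℕ) : ℝ :=
  (∑ N ∈ Finset.range (H (m + 1)), ((numSummands L c H N : ℝ) - meanBelow L c H m) ^ 2) / H (m + 1)

lemma varBelow_nonneg (m : ℕ) : 0 ≤ varBelow L c H m :=
  div_nonneg (Finset.sum_nonneg fun _ _ => sq_nonneg _) (Nat.cast_nonneg _)

lemma sum_sub_sq (hH : IsPosLinRec L c H) (m : ℕ) (b : ℝ) :
    ∑ N ∈ Finset.range (H (m + 1)), ((numSummands L c H N : ℝ) - b) ^ 2 =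
      H (m + 1) * (varBelow L c H m + (meanBelow L c H m - b) ^ 2) := by
  have hp : (H (m + 1) : ℝ) ≠ 0 := by exact_mod_cast (pos hH m).ne'
  have h1 : ∑ N ∈ Finset.range (H (m + 1)),
      ((numSummands L c H N : ℝ) - meanBelow L c H m) = 0 := by
    rw [Finset.sum_sub_distrib, Finset.sum_const, Finset.card_range, nsmul_eq_mul, meanBelow,
      mul_div_cancel₀ _ hp, sub_self]
  rw [mul_add, varBelow, mul_div_cancel₀ _ hp]
  set μ := meanBelow L c H m
  calc _ = ∑ N ∈ Finset.range (H (m + 1)), (((numSummands L c H N : ℝ) - μ) ^ 2 +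
        2 * (μ - b) * ((numSummands L c H N : ℝ) - μ) + (μ - b) ^ 2) :=
        Finset.sum_congr rfl fun N _ => by ring
    _ = _ := by
      rw [Finset.sum_add_distrib, Finset.sum_add_distrib, ← Finset.mul_sum, h1, Finset.sum_const,
        Finset.card_range, nsmul_eq_mul]
      ring

lemma sum_block_sub_sq (hH : IsPosLinRec L c H) {m s : ℕ} (hs : s < L) (hm : L ≤ m) (k : ℕ)
    (b : ℝ) :
    ∑ r ∈ Finset.range (H (m - s)), (((k + numSummands L c H r : ℕ) : ℝ) - b) ^ 2 =
      H (m - s) * (varBelow L c H (m - 1 - s) + (k + meanBelow L c H (m - 1 - s) - b) ^ 2) := by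
  have h := sum_sub_sq hH (m - 1 - s) (b - k)
  rw [show m - 1 - s + 1 = m - s by omega] at h
  rw [show (k : ℝ) + meanBelow L c H (m - 1 - s) - b =
    meanBelow L c H (m - 1 - s) - (b - k) by ring, ← h]
  refine Finset.sum_congr rfl fun r _ => ?_
  push_cast
  ring

/-- The contribution to the variance on `[0, H (m + 1))` of the choice of the first block. -/
noncomputable def varGap (L : ℕ) (c H : ℕ → ℕ) (m : ℕ) : ℝ :=
  ∑ s ∈ Finset.range L, ∑ a ∈ Finset.range (c (s + 1)), (H (m - s) : ℝ) / H (m + 1) *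
    (((coeffSum c s + a : ℕ) : ℝ) + meanBelow L c H (m - 1 - s) - meanBelow L c H m) ^ 2

/-- Law of total variance, conditioning on the first block: the sum is the mean of the conditional
variances, `varGap` the variance of the conditional means. -/
lemma varBelow_rec (hH : IsPosLinRec L c H) (hne : ¬ (L = 1 ∧ c 1 = 1)) {m : ℕ} (hm : L ≤ m) :
    varBelow L c H m = ∑ s ∈ Finset.range L, blockProb c H m s * varBelow L c H (m - 1 - s) +
      varGap L c H m := by
  rw [varBelow, sum_numSummands hH hne (fun k => ((k : ℝ) - meanBelow L c H m) ^ 2) hm, varGap,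
    ← Finset.sum_add_distrib, Finset.sum_div]
  refine Finset.sum_congr rfl fun s hs => ?_
  rw [Finset.mem_range] at hs
  simp only [sum_block_sub_sq hH hs hm]
  rw [← Finset.mul_sum, Finset.sum_add_distrib, Finset.sum_const, Finset.card_range, nsmul_eq_mul,
    ← Finset.mul_sum, blockProb]
  ring

lemma le_varGap {m s a : ℕ} (hs : s < L) (ha : a < c (s + 1)) :
    (H (m - s) : ℝ) / H (m + 1) * (((coeffSum c s + a : ℕ) : ℝ) + meanBelow L c H (m - 1 - s) -
      meanBelow L c H m) ^ 2 ≤ varGap L c H m := by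
  refine le_trans ?_ (Finset.single_le_sum (f := fun s => ∑ a ∈ Finset.range (c (s + 1)),
    (H (m - s) : ℝ) / H (m + 1) * (((coeffSum c s + a : ℕ) : ℝ) + meanBelow L c H (m - 1 - s) -
      meanBelow L c H m) ^ 2) (fun s _ => Finset.sum_nonneg fun a _ => by positivity)
    (Finset.mem_range.2 hs))
  exact Finset.single_le_sum (f := fun a => (H (m - s) : ℝ) / H (m + 1) *
    (((coeffSum c s + a : ℕ) : ℝ) + meanBelow L c H (m - 1 - s) - meanBelow L c H m) ^ 2)
    (fun a _ => by positivity) (Finset.mem_range.2 ha)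

lemma varGap_nonneg (m : ℕ) : 0 ≤ varGap L c H m :=
  Finset.sum_nonneg fun s _ => Finset.sum_nonneg fun a _ => by positivity

lemma pow_le_div (hH : IsPosLinRec L c H) {m : ℕ} (s : ℕ) (hm : L + s ≤ m) :
    (coeffSum c L : ℝ)⁻¹ ^ (s + 1) ≤ (H (m - s) : ℝ) / H (m + 1) := by
  induction s with
  | zero => simpa using inv_le_div hH hm
  | succ s ih =>
    have h1 := inv_le_div hH (m := m - (s + 1)) (by omega)
    rw [show m - (s + 1) + 1 = m - s by omega] at h1
    have hp : (H (m - s) : ℝ) ≠ 0 := by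
      have := pos hH (m - (s + 1))
      rw [show m - (s + 1) + 1 = m - s by omega] at this
      exact_mod_cast this.ne'
    rw [pow_succ', ← div_mul_div_cancel₀ hp]
    exact mul_le_mul h1 (ih (by omega)) (by positivity) (by positivity)

/-- In every window of `L` consecutive indices, the choice of the first block contributes to the
variance for some index. -/
lemma exists_le_varGap (hH : IsPosLinRec L c H) (hne : ¬ (L = 1 ∧ c 1 = 1)) :
    ∃ δ > 0, ∀ m, L ≤ m → ∃ j < L, δ ≤ varGap L c H (m + L + j) := by
  have hL := hH.one_le_length
  have hc : (1 : ℝ) ≤ coeffSum c L := by exact_mod_cast coeffSum_pos hH hL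
  set κ : ℝ := (coeffSum c L : ℝ)⁻¹ with hκ
  have hκ0 : 0 < κ := by positivity
  have hκ1 : κ ≤ 1 := inv_le_one_of_one_le₀ hc
  have hc1 := hH.first_pos
  rcases Nat.lt_or_ge 1 (c 1) with h2 | h2
  -- The one-digit blocks `0` and `1` are followed by the same range of integers, so their
  -- conditional means differ by exactly `1` and cannot both be close to the overall mean.
  · refine ⟨κ / 4, by positivity, fun m hm => ⟨0, hL, ?_⟩⟩
    have e0 := le_varGap (L := L) (H := H) (c := c) (m := m + L + 0) (s := 0) (a := 0) hL hc1
    have e1 := le_varGap (L := L) (H := H) (c := c) (m := m + L + 0) (s := 0) (a := 1) hL h2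
    have e2 := inv_le_div hH (m := m + L + 0) (by omega)
    simp only [Nat.sub_zero] at e0 e1
    rw [← hκ] at e2
    generalize meanBelow L c H (m + L + 0 - 1) = x at e0 e1
    generalize meanBelow L c H (m + L + 0) = y at e0 e1
    generalize (H (m + L + 0) : ℝ) / H (m + L + 0 + 1) = q at e0 e1 e2
    simp only [coeffSum, Finset.range_zero, Finset.sum_empty, add_zero, zero_add, Nat.cast_zero,
      Nat.cast_one] at e0 e1
    have hq : 0 ≤ q := by linarith
    have e3 : q * (1 / 2) ≤ q * ((x - y) ^ 2 + (1 + x - y) ^ 2) := by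
      gcongr
      nlinarith [sq_nonneg (2 * (x - y) + 1)]
    rw [mul_add] at e3
    rw [add_zero]
    linarith
  · have hL2 : 2 ≤ L := by
      by_contra h
      exact hne ⟨by omega, by omega⟩
    have hLr : (0 : ℝ) < L := by exact_mod_cast hL
    -- If all gaps in the window were small, the block `0` would force the mean to change by at most
    -- `1 / 2` over `L` steps, while the block of length `L` ending in the digit `0` (allowed
    -- because `c L > 0`) would force a change of more than `coeffSum c (L - 1) - 1 / 2 ≥ 1 / 2`.
    -- The factor `κ ^ L` bounds the probability of each digit choice from below.
    refine ⟨κ ^ L * (1 / (2 * L)) ^ 2, by positivity, fun m hm => ?_⟩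
    by_contra! hcon
    set M := meanBelow L c H with hM
    have hsmall : ∀ s j, s < L → j < L → 0 < c (s + 1) →
        |(coeffSum c s : ℝ) + M (m + L + j - 1 - s) - M (m + L + j)| < 1 / (2 * L) := by
      intro s j hs hj hcs
      have e1 := (le_varGap (L := L) (H := H) (c := c) (m := m + L + j) (s := s) (a := 0) hs
        hcs).trans_lt (hcon j hj)
      have e2 := pow_le_div hH (m := m + L + j) s (by omega)
      have e3 : κ ^ L ≤ κ ^ (s + 1) := pow_le_pow_of_le_one hκ0.le hκ1 hs
      rw [add_zero] at e1
      refine abs_lt_of_sq_lt_sq ?_ (by positivity)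
      refine lt_of_mul_lt_mul_left (lt_of_le_of_lt ?_ e1) (pow_nonneg hκ0.le L)
      exact mul_le_mul_of_nonneg_right (e3.trans e2) (sq_nonneg _)
    have hstep : ∀ j < L, |M (m + L + j) - M (m + L + j - 1)| < 1 / (2 * L) := by
      intro j hj
      have := hsmall 0 j hL hj hc1
      rwa [coeffSum, Finset.sum_range_zero, Nat.cast_zero, zero_add, Nat.sub_zero,
        abs_sub_comm] at this
    have hsum : ∀ j ≤ L, |M (m + L + j - 1) - M (m + L - 1)| ≤ j * (1 / (2 * L)) := by
      intro j
      induction j with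
      | zero => simp
      | succ j ih =>
        intro hj
        have e1 := ih (by omega)
        have e2 := hstep j (by omega)
        rw [show m + L + (j + 1) - 1 = m + L + j by omega]
        have e3 := abs_sub_le (M (m + L + j)) (M (m + L + j - 1)) (M (m + L - 1))
        push_cast
        linarith
    have e1 := hsum L le_rfl
    have e2 := hsmall (L - 1) (L - 1) (by omega) (by omega)
      (by rw [Nat.sub_add_cancel hL]; exact hH.last_pos)
    rw [show m + L + (L - 1) - 1 - (L - 1) = m + L - 1 by omega,
      show m + L + (L - 1) = m + L + L - 1 by omega] at e2
    have e3 : (1 : ℝ) ≤ coeffSum c (L - 1) := by exact_mod_cast coeffSum_pos hH (by omega)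
    have e4 : (L : ℝ) * (1 / (2 * L)) = 1 / 2 := by field_simp
    have e5 : 1 / (2 * (L : ℝ)) ≤ 1 / 2 := by
      rw [← e4]
      have : (1 : ℝ) ≤ L := by exact_mod_cast hL
      have h0 : 0 ≤ 1 / (2 * (L : ℝ)) := by positivity
      nlinarith
    rw [e4] at e1
    linarith [(abs_le.1 e1).2, (abs_lt.1 e2).2]

/-- Dropping the nonnegative `varGap` leaves an averaging inequality without error, so
`lower_propagation` applies with `E = 0`. -/
lemma varBelow_propagation (hH : IsPosLinRec L c H) (hne : ¬ (L = 1 ∧ c 1 = 1)) {m : ℕ} {lo : ℝ}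
    (hlo : ∀ i < L, lo ≤ varBelow L c H (m + i)) (j : ℕ) :
    lo + (coeffSum c L : ℝ)⁻¹ ^ j * (varBelow L c H (m + (L - 1)) - lo) ≤
      varBelow L c H (m + (L - 1 + j)) := by
  have hL := hH.one_le_length
  have := lower_propagation (W := L) (J := j) (κ := (coeffSum c L : ℝ)⁻¹) (E := 0) (lo := lo)
    (u := fun i => varBelow L c H (m + i)) (p := fun j s => blockProb c H (m + L + j) s) hL
    (by positivity) le_rfl (fun j s _ => blockProb_nonneg _ _)
    (fun j => sum_blockProb hH (by omega)) (fun j => inv_le_blockProb hH (by omega)) hlo ?_ j le_rfl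
  · simpa using this
  · intro j _
    rw [show m + (L + j) = m + L + j by ring, varBelow_rec hH hne (m := m + L + j) (by omega),
      sub_zero]
    refine le_trans (le_of_eq ?_) (le_add_of_nonneg_right (varGap_nonneg _))
    refine Finset.sum_congr rfl fun s hs => ?_
    rw [Finset.mem_range] at hs
    rw [show m + (L + j - 1 - s) = m + L + j - 1 - s by omega]

lemma le_varBelow_of_window (hH : IsPosLinRec L c H) (hne : ¬ (L = 1 ∧ c 1 = 1)) {m : ℕ} {lo : ℝ}
    (hlo : ∀ i < L, lo ≤ varBelow L c H (m + i)) (i : ℕ) : lo ≤ varBelow L c H (m + i) := by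
  have hL := hH.one_le_length
  rcases Nat.lt_or_ge i L with h | h
  · exact hlo i h
  · have h1 := varBelow_propagation hH hne hlo (i - (L - 1))
    rw [show L - 1 + (i - (L - 1)) = i by omega] at h1
    refine le_trans ?_ h1
    exact le_add_of_nonneg_right (mul_nonneg (by positivity)
      (sub_nonneg.2 (hlo _ (by omega))))

/-- The variance of the number of summands on `[0, H (m + 1))` grows at least linearly. -/
lemma exists_linear_le_varBelow (hH : IsPosLinRec L c H) (hne : ¬ (L = 1 ∧ c 1 = 1)) :
    ∃ θ > 0, ∀ k i : ℕ, k * θ ≤ varBelow L c H (L + 3 * L * k + i) := by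
  have hL := hH.one_le_length
  obtain ⟨δ, hδ, hgap⟩ := exists_le_varGap hH hne
  have hc : (1 : ℝ) ≤ coeffSum c L := by exact_mod_cast coeffSum_pos hH hL
  set κ : ℝ := (coeffSum c L : ℝ)⁻¹ with hκ
  have hκ0 : 0 < κ := by positivity
  have hκ1 : κ ≤ 1 := inv_le_one_of_one_le₀ hc
  -- In each period of `3 * L` indices some gap adds `δ` at one index `m + L + j`. At most `3 * L`
  -- steps carry this excess to every index of the window starting at `m + 3 * L`, with a loss of at
  -- most `κ ^ (3 * L)`.
  refine ⟨κ ^ (3 * L) * δ, by positivity, fun k => ?_⟩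
  induction k with
  | zero => intro i; simpa using varBelow_nonneg _
  | succ k ih =>
    set m := L + 3 * L * k with hm
    set lo : ℝ := k * (κ ^ (3 * L) * δ)
    obtain ⟨j, hj, hjδ⟩ := hgap m (by omega)
    have hx : lo + δ ≤ varBelow L c H (m + L + j) := by
      rw [varBelow_rec hH hne (by omega)]
      refine add_le_add ?_ hjδ
      rw [← one_mul lo, ← sum_blockProb hH (m := m + L + j) (by omega), Finset.sum_mul]
      refine Finset.sum_le_sum fun s hs => mul_le_mul_of_nonneg_left ?_ (blockProb_nonneg _ _)
      rw [Finset.mem_range] at hs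
      have := ih (L + j - 1 - s)
      rwa [show m + (L + j - 1 - s) = m + L + j - 1 - s by omega] at this
    intro i
    rw [show L + 3 * L * (k + 1) + i = m + 3 * L + i by rw [hm]; ring]
    refine le_varBelow_of_window hH hne (fun i hi => ?_) i
    have h1 := varBelow_propagation hH hne (m := m + (j + 1)) (lo := lo)
      (fun i _ => by rw [add_assoc]; exact ih _) (2 * L + i - j)
    rw [show m + (j + 1) + (L - 1) = m + L + j by omega,
      show m + (j + 1) + (L - 1 + (2 * L + i - j)) = m + 3 * L + i by omega] at h1
    refine le_trans ?_ h1
    have h2 : κ ^ (3 * L) ≤ κ ^ (2 * L + i - j) := pow_le_pow_of_le_one hκ0.le hκ1 (by omega)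
    have h3 : κ ^ (3 * L) * δ ≤ κ ^ (2 * L + i - j) * (varBelow L c H (m + L + j) - lo) :=
      mul_le_mul h2 (by linarith) hδ.le (by positivity)
    push_cast
    linarith

/-- The variance of the number of summands on `[H m, H (m + 1))` grows at least linearly. -/
lemma exists_linear_le_sum_Ico (hH : IsPosLinRec L c H) (hne : ¬ (L = 1 ∧ c 1 = 1)) :
    ∃ θ > 0, ∀ m, 8 * L ≤ m → ∀ b : ℝ, θ * m * ((H (m + 1) : ℝ) - H m) ≤
      ∑ N ∈ Finset.Ico (H m) (H (m + 1)), ((numSummands L c H N : ℝ) - b) ^ 2 := by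
  have hL := hH.one_le_length
  obtain ⟨θ, hθ, h⟩ := exists_linear_le_varBelow hH hne
  have hLr : (0 : ℝ) < L := by exact_mod_cast hL
  refine ⟨θ / (8 * L), by positivity, fun m hm b => ?_⟩
  -- The largest `k` for which every index `m - 1 - s` with `s < L` is at least `L + 3 * L * k`. The
  -- condition `8 * L ≤ m` makes `k` positive, whence `m ≤ 8 * L * k`.
  set k := (m - 2 * L) / (3 * L) with hk
  have hkm : 3 * L * k ≤ m - 2 * L := Nat.mul_div_le _ _
  have hkm' : m - 2 * L < 3 * L * (k + 1) := Nat.lt_mul_div_succ _ (by omega)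
  have hkr : (m : ℝ) ≤ 8 * L * k := by
    have h1 : 0 < k := by
      by_contra h0
      replace h0 : k = 0 := Nat.eq_zero_of_not_pos h0
      rw [h0] at hkm'
      omega
    have h2 : m ≤ 8 * L * k := by
      have h3 : m < 3 * L * k + 5 * L := by
        have : 3 * L * (k + 1) = 3 * L * k + 3 * L := by ring
        omega
      nlinarith
    exact_mod_cast h2
  rw [sum_Ico_numSummands hH hne (fun k => ((k : ℝ) - b) ^ 2) (by omega),
    sum_Ico_card hH hne (by omega), Finset.mul_sum]
  refine Finset.sum_le_sum fun s hs => ?_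
  rw [Finset.mem_range] at hs
  have h1 : θ / (8 * L) * m ≤ varBelow L c H (m - 1 - s) := by
    have h2 := h k (m - 1 - s - (L + 3 * L * k))
    rw [show L + 3 * L * k + (m - 1 - s - (L + 3 * L * k)) = m - 1 - s by omega] at h2
    refine le_trans ?_ h2
    rw [div_mul_eq_mul_div, div_le_iff₀ (by positivity)]
    nlinarith
  -- The second moment about any centre is at least the variance, so the mean over `[H m, H (m +
  -- 1))` need not be related to the means over the pieces.
  rw [mul_left_comm, ← nsmul_eq_mul, ← Finset.sum_const]
  refine Finset.sum_le_sum fun a _ => ?_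
  rw [sum_block_sub_sq hH hs (by omega), mul_comm (θ / (8 * L) * m)]
  refine mul_le_mul_of_nonneg_left ?_ (Nat.cast_nonneg _)
  linarith [sq_nonneg ((((coeffSum c s + a : ℕ) : ℝ)) + meanBelow L c H (m - 1 - s) - b)]

/-! ### Cauchy-type bounds for cumulants -/

lemma mapsTo_closedBall_of_norm_le {g : ℂ → ℂ} {ρ B : ℝ}
    (hρ : 0 < ρ) (h : ∀ z ∈ Metric.ball (0 : ℂ) ρ, ‖g z‖ ≤ B) :
    Set.MapsTo g (Metric.ball 0 ρ) (Metric.closedBall (g 0) (2 * B)) := by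
  intro z hz
  rw [mem_closedBall_iff_norm]
  have h1 := h z hz
  have h2 := h 0 (Metric.mem_ball_self hρ)
  linarith [norm_sub_le (g z) (g 0)]

/-- Second order Taylor expansion with a Cauchy-type bound for the remainder. -/
lemma exists_taylor_bound {f : ℂ → ℂ} {ρ B : ℝ} (hρ : 0 < ρ)
    (hf : DifferentiableOn ℂ f (Metric.ball 0 ρ)) (h0 : f 0 = 0)
    (hB : ∀ z ∈ Metric.ball (0 : ℂ) ρ, ‖f z‖ ≤ B) :
    ∀ z ∈ Metric.ball (0 : ℂ) ρ,
      ‖f z - deriv f 0 * z - deriv (deriv f) 0 / 2 * z ^ 2‖ ≤ 8 * B / ρ ^ 3 * ‖z‖ ^ 3 := by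
  have hnhds : Metric.ball (0 : ℂ) ρ ∈ nhds 0 := Metric.ball_mem_nhds 0 hρ
  -- One division by `z` costs a factor `2 / ρ` by the Schwarz lemma. Three divisions leave the
  -- cubic remainder with the constant `8 * B / ρ ^ 3`.
  have step : ∀ {g : ℂ → ℂ} {D : ℝ}, DifferentiableOn ℂ g (Metric.ball 0 ρ) →
      (∀ z ∈ Metric.ball (0 : ℂ) ρ, ‖g z‖ ≤ D) →
      DifferentiableOn ℂ (dslope g 0) (Metric.ball 0 ρ) ∧
      (∀ z ∈ Metric.ball (0 : ℂ) ρ, ‖dslope g 0 z‖ ≤ 2 * D / ρ) ∧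
      ∀ z, g z = g 0 + z * dslope g 0 z := by
    intro g D hg hD
    refine ⟨(Complex.differentiableOn_dslope hnhds).2 hg, fun z hz =>
      Complex.norm_dslope_le_div_of_mapsTo_ball hg (mapsTo_closedBall_of_norm_le hρ hD) hz,
      fun z => ?_⟩
    have := sub_smul_dslope g 0 z
    rw [sub_zero, smul_eq_mul] at this
    rw [this]; ring
  obtain ⟨d1, b1, e1⟩ := step hf hB
  obtain ⟨d2, b2, e2⟩ := step d1 b1
  obtain ⟨d3, b3, e3⟩ := step d2 b2
  set g1 := dslope f 0
  set g2 := dslope g1 0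
  set g3 := dslope g2 0
  have hα : deriv f 0 = g1 0 := (dslope_same f 0).symm
  have hf2 : ∀ z, f z = g1 0 * z + z ^ 2 * g2 z := by
    intro z
    rw [e1 z, e2 z, h0]; ring
  have hderiv : ∀ z ∈ Metric.ball (0 : ℂ) ρ,
      deriv f z = g1 0 + (2 * z * g2 z + z ^ 2 * deriv g2 z) := by
    intro z hz
    have hg2 := (d2.differentiableAt (Metric.isOpen_ball.mem_nhds hz)).hasDerivAt
    have h1 := ((hasDerivAt_id z).const_mul (g1 0)).add (((hasDerivAt_id z).pow 2).mul hg2)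
    have h2 : f = (fun y => g1 0 * id y) + (id ^ 2 * g2) := by
      funext z; simpa using hf2 z
    rw [h2, h1.deriv]
    simp
  have hβ : deriv (deriv f) 0 = 2 * g2 0 := by
    have hev : deriv f =ᶠ[nhds 0] fun z => g1 0 + (2 * z * g2 z + z ^ 2 * deriv g2 z) := by
      filter_upwards [hnhds] with z hz using hderiv z hz
    rw [hev.deriv_eq]
    have hg2 := (d2.differentiableAt hnhds).hasDerivAt
    have hg2' := ((d2.deriv Metric.isOpen_ball).differentiableAt hnhds).hasDerivAt
    have h1 := ((((hasDerivAt_id (0 : ℂ)).const_mul 2).mul hg2).add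
      (((hasDerivAt_id (0 : ℂ)).pow 2).mul hg2')).const_add (g1 0)
    have h2 : (fun z => g1 0 + (2 * z * g2 z + z ^ 2 * deriv g2 z)) =
      fun x => g1 0 + ((fun y : ℂ => 2 * id y) * g2 + id ^ 2 * deriv g2 : ℂ → ℂ) x := by
      funext z; simp
    rw [h2, h1.deriv]
    simp
  intro z hz
  have e : f z - deriv f 0 * z - deriv (deriv f) 0 / 2 * z ^ 2 = g3 z * z ^ 3 := by
    rw [hf2, hα, hβ, e3 z]; ring
  rw [e, norm_mul, norm_pow]
  refine mul_le_mul_of_nonneg_right ((b3 z hz).trans (le_of_eq ?_)) (by positivity)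
  field_simp
  ring

/-- If the moment generating function of a finitely supported uniform random variable has an
analytic logarithm of size at most `B` on a disc, its cumulants of order at least three are
controlled by `B`. -/
lemma norm_log_sub_cumulants_le {ι : Type*} {S : Finset ι} (hS : S.Nonempty) (k : ι → ℝ)
    {f : ℂ → ℂ} {ρ B : ℝ} (hρ : 0 < ρ) (hf : DifferentiableOn ℂ f (Metric.ball 0 ρ)) (h0 : f 0 = 0)
    (hexp : ∀ z ∈ Metric.ball (0 : ℂ) ρ,
      Complex.exp (f z) = (∑ N ∈ S, Complex.exp (z * k N)) / S.card)
    (hB : ∀ z ∈ Metric.ball (0 : ℂ) ρ, ‖f z‖ ≤ B) {μ v : ℝ} (hμ : μ = (∑ N ∈ S, k N) / S.card)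
    (hv : v = (∑ N ∈ S, (k N - μ) ^ 2) / S.card) :
    ∀ z ∈ Metric.ball (0 : ℂ) ρ, ‖f z - μ * z - v / 2 * z ^ 2‖ ≤ 8 * B / ρ ^ 3 * ‖z‖ ^ 3 := by
  have hcard : (S.card : ℝ) ≠ 0 := by exact_mod_cast hS.card_pos.ne'
  have hnhds : Metric.ball (0 : ℂ) ρ ∈ nhds 0 := Metric.ball_mem_nhds 0 hρ
  set F : ℂ → ℂ := fun z => (∑ N ∈ S, Complex.exp (z * k N)) / S.card
  set F1 : ℂ → ℂ := fun z => (∑ N ∈ S, Complex.exp (z * k N) * k N) / S.card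
  set F2 : ℂ → ℂ := fun z => (∑ N ∈ S, Complex.exp (z * k N) * k N * k N) / S.card
  have hterm : ∀ N z, HasDerivAt (fun z : ℂ => Complex.exp (z * k N))
      (Complex.exp (z * k N) * k N) z := by
    intro N z
    simpa using ((hasDerivAt_id z).mul_const (k N : ℂ)).cexp
  have hF : ∀ z, HasDerivAt F (F1 z) z := fun z =>
    (HasDerivAt.fun_sum fun N _ => hterm N z).div_const _
  have hF1 : ∀ z, HasDerivAt F1 (F2 z) z := fun z =>
    (HasDerivAt.fun_sum fun N _ => (hterm N z).mul_const _).div_const _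
  -- Since `f` is known only through `exp f = F`, its derivatives at `0` are read off from the
  -- logarithmic derivative of `F`.
  have hf' : ∀ z ∈ Metric.ball (0 : ℂ) ρ, deriv f z = F1 z / F z := by
    intro z hz
    have hz' := Metric.isOpen_ball.mem_nhds hz
    have h1 := (hf.differentiableAt hz').hasDerivAt.cexp
    have h2 : (fun x => Complex.exp (f x)) =ᶠ[nhds z] F := by
      filter_upwards [hz'] with x hx using hexp x hx
    have h3 := (h1.congr_of_eventuallyEq h2.symm).unique (hF z)
    have h4 : F z ≠ 0 := by
      rw [← show Complex.exp (f z) = F z from hexp z hz]; exact Complex.exp_ne_zero _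
    rw [eq_div_iff h4, ← h3, ← show Complex.exp (f z) = F z from hexp z hz]
    ring
  have hF0 : F 0 = 1 := by
    have : (S.card : ℂ) ≠ 0 := by exact_mod_cast hcard
    simp [F, this]
  have hF10 : F1 0 = μ := by
    rw [hμ]; simp [F1]
  have hF20 : F2 0 = v + μ ^ 2 := by
    have h1 : ∑ N ∈ S, (k N - μ) ^ 2 = ∑ N ∈ S, k N * k N - S.card * μ ^ 2 := by
      have h2 : ∑ N ∈ S, k N = S.card * μ := by rw [hμ, mul_div_cancel₀ _ hcard]
      calc _ = ∑ N ∈ S, (k N * k N - 2 * μ * k N + μ ^ 2) :=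
            Finset.sum_congr rfl fun N _ => by ring
        _ = _ := by
          rw [Finset.sum_add_distrib, Finset.sum_sub_distrib, ← Finset.mul_sum, h2,
            Finset.sum_const, nsmul_eq_mul]
          ring
    have h3 : (∑ N ∈ S, k N * k N) / S.card = v + μ ^ 2 := by
      rw [hv, h1]; field_simp; ring
    have h4 := congrArg (fun x : ℝ => (x : ℂ)) h3
    push_cast at h4
    rw [← h4]
    simp [F2]
  have hd1 : deriv f 0 = μ := by
    rw [hf' 0 (Metric.mem_ball_self hρ), hF0, hF10, div_one]
  have hd2 : deriv (deriv f) 0 = v := by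
    have hev : deriv f =ᶠ[nhds 0] fun z => F1 z / F z := by
      filter_upwards [hnhds] with z hz using hf' z hz
    rw [hev.deriv_eq]
    have := ((hF1 0).div (hF 0) (by rw [hF0]; exact one_ne_zero)).deriv
    rw [hF0, hF10, hF20] at this
    refine this.trans ?_
    ring
  intro z hz
  have := exists_taylor_bound hρ hf h0 hB z hz
  rwa [hd1, hd2] at this

/-! ### Characteristic functions and the limit law -/

lemma integral_uniformOn_finset {α E : Type*} [MeasurableSpace α] [MeasurableSingletonClass α]
    [NormedAddCommGroup E] [NormedSpace ℝ E] [CompleteSpace E] (S : Finset α) (f : α → E) :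
    ∫ x, f x ∂(uniformOn (S : Set α)) = (S.card : ℝ)⁻¹ • ∑ x ∈ S, f x := by
  rw [uniformOn, ProbabilityTheory.cond, integral_smul_measure, Measure.count_apply_finset,
    setIntegral_finset S]
  · simp [measureReal_def]
  · rw [← (S : Set α).biUnion_of_singleton]
    exact integrableOn_finset_iUnion.2 fun x _ =>
      integrableOn_singleton (by finiteness) (by simp)

lemma unifInterval_eq (m : ℕ) :
    unifInterval H m = uniformOn (Finset.Ico (H m) (H (m + 1)) : Set ℕ) := by
  rw [unifInterval, Finset.coe_Ico]

lemma isProbabilityMeasure_unifInterval (hH : IsPosLinRec L c H) (hne : ¬ (L = 1 ∧ c 1 = 1))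
    {m : ℕ} (hm : 1 ≤ m) : IsProbabilityMeasure (unifInterval H m) :=
  isProbabilityMeasure_uniformOn (Set.finite_Ico _ _) (Set.nonempty_Ico.2 (lt_succ hH hne hm))

lemma integral_unifInterval (m : ℕ) (f : ℕ → ℝ) :
    ∫ N, f N ∂(unifInterval H m) = (∑ N ∈ Finset.Ico (H m) (H (m + 1)), f N) /
      (Finset.Ico (H m) (H (m + 1))).card := by
  rw [unifInterval_eq, integral_uniformOn_finset, smul_eq_mul, inv_mul_eq_div]

lemma variance_unifInterval (m : ℕ) (f : ℕ → ℝ) :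
    Var[f; unifInterval H m] = (∑ N ∈ Finset.Ico (H m) (H (m + 1)),
      (f N - ∫ M, f M ∂(unifInterval H m)) ^ 2) / (Finset.Ico (H m) (H (m + 1))).card := by
  rw [variance_eq_integral (measurable_of_countable f).aemeasurable, integral_unifInterval m]

lemma charFun_map_unifInterval (m : ℕ) (k : ℕ → ℝ) (μ σ t : ℝ) :
    charFun ((unifInterval H m).map fun N => (k N - μ) / σ) t =
      Complex.exp (-(μ * (t / σ * Complex.I))) *
        ((∑ N ∈ Finset.Ico (H m) (H (m + 1)), Complex.exp (t / σ * Complex.I * k N)) /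
          (Finset.Ico (H m) (H (m + 1))).card) := by
  rw [charFun_apply_real, integral_map (measurable_of_countable _).aemeasurable
    (by fun_prop), unifInterval_eq, integral_uniformOn_finset, ← mul_div_assoc, Finset.mul_sum,
    Complex.real_smul, div_eq_inv_mul]
  push_cast
  congr 1
  refine Finset.sum_congr rfl fun N _ => ?_
  rw [← Complex.exp_add]
  congr 1
  ring

/-- The characteristic functions of the standardized numbers of summands converge to that of the
standard normal distribution. -/
lemma tendsto_charFun_standardizedSummands (hH : IsPosLinRec L c H) (hne : ¬ (L = 1 ∧ c 1 = 1))
    (t : ℝ) : Tendsto (fun m => charFun ((unifInterval H m).map (standardizedSummands L c H m)) t)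
      atTop (nhds (Complex.exp (-t ^ 2 / 2))) := by
  have hL := hH.one_le_length
  obtain ⟨ρ, hρ, hlog⟩ := exists_log_mgfIco hH hne
  obtain ⟨θ, hθ, hvar⟩ := exists_linear_le_sum_Ico hH hne
  set S : ℕ → Finset ℕ := fun m => Finset.Ico (H m) (H (m + 1)) with hS
  set μ : ℕ → ℝ := fun m => ∫ M, (numSummands L c H M : ℝ) ∂(unifInterval H m) with hμ
  set v : ℕ → ℝ := fun m => Var[fun M => (numSummands L c H M : ℝ); unifInterval H m] with hv
  have hvge : ∀ m, 8 * L ≤ m → θ * m ≤ v m := by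
    intro m hm
    have hlt := lt_succ hH hne (m := m) (by omega)
    have hcard : ((S m).card : ℝ) = H (m + 1) - H m := by
      rw [hS, Nat.card_Ico, Nat.cast_sub hlt.le]
    have hpos : (0 : ℝ) < H (m + 1) - H m := sub_pos.2 (by exact_mod_cast hlt)
    rw [hv]
    simp only
    rw [variance_unifInterval, le_div_iff₀ (by rw [hcard]; exact hpos), hcard]
    exact hvar m hm _
  have hσ : Tendsto (fun m => √(v m)) atTop atTop := by
    refine Real.tendsto_sqrt_atTop.comp (tendsto_atTop_mono' _ ?_
      (tendsto_natCast_atTop_atTop.const_mul_atTop hθ))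
    filter_upwards [eventually_ge_atTop (8 * L)] with m hm using hvge m hm
  choose! f hfd hf0 hf using hlog
  have hsmall : Tendsto (fun m => |t| / √(v m)) atTop (nhds 0) := hσ.const_div_atTop _
  set z : ℕ → ℂ := fun m => t / √(v m) * Complex.I with hz
  have hznorm : ∀ m, ‖z m‖ = |t| / √(v m) := by
    intro m
    simp [hz, abs_of_nonneg (Real.sqrt_nonneg _)]
  have hball : ∀ᶠ m in atTop, z m ∈ Metric.ball (0 : ℂ) ρ := by
    filter_upwards [hsmall.eventually_lt_const hρ] with m hm
    rwa [mem_ball_zero_iff, hznorm]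
  have herr : Tendsto (fun m => f m (z m) - μ m * z m + t ^ 2 / 2) atTop (nhds 0) := by
    -- The remainder `8 * m / ρ ^ 3 * (|t| / σ) ^ 3` is a multiple of `(m / σ ^ 2) / σ`, and `m / σ
    -- ^ 2 ≤ 1 / θ`.
    refine squeeze_zero_norm' ?_ (a := fun m => 8 * |t| ^ 3 / (ρ ^ 3 * θ) / √(v m))
      (hσ.const_div_atTop _)
    filter_upwards [hball, eventually_ge_atTop (8 * L)] with m hm hmL
    have hlt := lt_succ hH hne (m := m) (by omega)
    have hvm := hvge m hmL
    have hmpos : (0 : ℝ) < m := by exact_mod_cast (by omega : 0 < m)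
    have hv0 : 0 < v m := lt_of_lt_of_le (by positivity) hvm
    have hs0 : 0 < √(v m) := Real.sqrt_pos.2 hv0
    have key := norm_log_sub_cumulants_le (S := S m) (Finset.nonempty_Ico.2 hlt)
      (fun N => (numSummands L c H N : ℝ)) hρ (hfd m (by omega)) (hf0 m (by omega))
      (fun z hz => by
        rw [((hf m (by omega)) z hz).1, mgfIco, hS, Nat.card_Ico, Nat.cast_sub hlt.le]
        simp)
      (fun z hz => ((hf m (by omega)) z hz).2) (integral_unifInterval m _)
      (variance_unifInterval m _) (z m) hm
    have hz2 : (v m : ℂ) / 2 * z m ^ 2 = -(t ^ 2 / 2) := by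
      have h1 : (((√(v m)) ^ 2 : ℝ) : ℂ) = v m := by rw [Real.sq_sqrt hv0.le]
      have h2 : ((√(v m) : ℝ) : ℂ) ≠ 0 := by exact_mod_cast hs0.ne'
      rw [hz, ← h1]
      push_cast
      rw [mul_pow, Complex.I_sq]
      field_simp
    change ‖f m (z m) - μ m * z m - v m / 2 * z m ^ 2‖ ≤ _ at key
    rw [hz2, sub_neg_eq_add, hznorm] at key
    refine key.trans ?_
    have h3 : (√(v m)) ^ 2 = v m := Real.sq_sqrt hv0.le
    have h4 : 8 * (m : ℝ) / ρ ^ 3 * (|t| / √(v m)) ^ 3 =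
        8 * |t| ^ 3 / ρ ^ 3 / √(v m) * (m / v m) := by
      rw [← h3]; field_simp; simp only [h3]
    have h5 : (m : ℝ) / v m ≤ 1 / θ := by
      rw [div_le_div_iff₀ hv0 hθ]; linarith
    rw [h4]
    calc _ ≤ 8 * |t| ^ 3 / ρ ^ 3 / √(v m) * (1 / θ) := by gcongr
      _ = _ := by field_simp
  have hexp : Tendsto (fun m => Complex.exp (f m (z m) - μ m * z m + t ^ 2 / 2 + -t ^ 2 / 2)) atTop
      (nhds (Complex.exp (-t ^ 2 / 2))) := by
    have := (Complex.continuous_exp.tendsto _).comp (herr.add_const (-(t : ℂ) ^ 2 / 2))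
    rwa [zero_add] at this
  refine hexp.congr' ?_
  filter_upwards [hball, eventually_ge_atTop L] with m hm hmL
  have hlt := lt_succ hH hne (m := m) (by omega)
  have h1 := charFun_map_unifInterval (H := H) m (fun N => (numSummands L c H N : ℝ)) (μ m)
    (√(v m)) t
  change _ = charFun ((unifInterval H m).map fun N => ((numSummands L c H N : ℝ) - μ m) /
    √(v m)) t
  rw [h1, show f m (z m) - μ m * z m + (t : ℂ) ^ 2 / 2 + -(t : ℂ) ^ 2 / 2 =
    -(μ m * z m) + f m (z m) by ring, Complex.exp_add, ((hf m hmL) (z m) hm).1, mgfIco,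
    Nat.card_Ico, Nat.cast_sub hlt.le]
  simp [hz]

end PosLinRec

theorem mainTheorem2 (L : ℕ) (c H : ℕ → ℕ) (hH : IsPosLinRec L c H)
    (hne : ¬ (L = 1 ∧ c 1 = 1)) :
    (∀ N : ℕ, 1 ≤ N → ∃! a : List ℕ, IsLegalDecomp L c H N a) ∧
    (∃ _ : ∀ n : ℕ, IsProbabilityMeasure (unifInterval H (n + 1)),
      TendstoInDistribution (fun n : ℕ => standardizedSummands L c H (n + 1)) atTop
        (id : ℝ → ℝ) (fun n : ℕ => unifInterval H (n + 1)) (gaussianReal 0 1)) := by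
  -- The index is shifted to `n + 1` because `H 0` is arbitrary and `[H 0, H 1)` may be empty.
  have hprob : ∀ n : ℕ, IsProbabilityMeasure (unifInterval H (n + 1)) :=
    fun n => PosLinRec.isProbabilityMeasure_unifInterval hH hne (by omega)
  refine ⟨fun N hN => PosLinRec.existsUnique_isLegalDecomp hH hne hN, hprob,
    ⟨fun n => (measurable_of_countable _).aemeasurable, aemeasurable_id, ?_⟩⟩
  refine ProbabilityMeasure.tendsto_iff_tendsto_charFun.2 fun t => ?_
  have h := (PosLinRec.tendsto_charFun_standardizedSummands hH hne t).comp (tendsto_add_atTop_nat 1)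
  simpa [Function.comp_def, charFun_gaussianReal, neg_div] using h
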